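/- **q-Coloring on triangle-free graphs.** Let $q \ge 3$ be a fixed integer and let $\varepsilon > 0$. Unless the Strong Exponential Time Hypothesis (SETH) fails, there is no algorithm that decides, given a finite simple triangle-free graph $G$ together with the number $t$, whether $G$ has a proper vertex coloring with $q$ colors, in time $O^*((q-\varepsilon)^t)$, where $t$ is the (vertex deletion) distance of $G$ to a caterpillar forest. In particular, there is no such algorithm that is given $G$ only. Here: - A *caterpillar* is a tree $T$ containing a path $P$ such that every vertex of $T$ outside of $P$ is adjacent to a vertex of $P$. A *caterpillar forest* is a forest all of whose connected components are caterpillars. The *distance* of $G$ to a caterpillar forest is the least size of a set $S \subseteq V(G)$ such that $G - S$ is a caterpillar forest. - SETH is the statement: for every $\varepsilon > 0$ there is a $k$ such that $k$-SAT (satisfiability of CNF formulas all of whose clauses have size at most $k$) on $n$ variables cannot be solved in time $O^*((2-\varepsilon)^n)$. - A problem with parameter $k$ is solved in time $O^*(b^k)$ if some deterministic Turing machine (with finitely many stacks) decides each of its instances, encoded as a binary word $w$, in at most $p(|w|)\cdot b^k$ steps, for some polynomial $p$. Formulas are encoded by their number of variables and their list of clauses, graphs by their number of vertices and a list of their edges,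 with numbers in unary. -/

import Mathlib

namespace FineGrained

/-! ### Decision problems with a parameter, and running times of the form `O*(b ^ k)` -/

/-- A (promise) decision problem with a parameter: a type of instances, the binary word by which an
instance is presented to an algorithm, the value of the parameter, and the set of yes-instances.
Words that do not encode an instance are outside of the promise. -/
structure ParamProblem where
  /-- the instances -/
  Inst : Type
  /-- the binary word that is the input of an algorithm -/
  encode : Inst → List Bool
  /-- the parameter -/
  param : Inst → ℕ
  /-- the yes-instances -/
  yes : Inst → Prop

/-- `P` can be solved in time `O*(b ^ k)`, `k` the parameter: there are one Turing machine with
finitely many stacks and one polynomial `p` such that on every instance of `P`, with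
input word `w` and parameter `k`, the machine halts after at most `p(|w|) * b ^ k` steps with the
single symbol on its output stack that says whether the instance is a yes-instance. -/
def SolvableInOStar (P : ParamProblem) (b : ℝ) : Prop :=
  ∃ (M : Turing.TM2ComputableAux Bool Bool) (p : Polynomial ℕ), ∀ x : P.Inst,
    ∃ (T : ℕ) (ans : Bool),
      (T : ℝ) ≤ ((p.eval (P.encode x).length : ℕ) : ℝ) * b ^ (P.param x) ∧
      (ans = true ↔ P.yes x) ∧
      Nonempty (Turing.TM2OutputsInTime M.tm
        ((P.encode x).map M.inputAlphabet.symm)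
        (some ([ans].map M.outputAlphabet.symm)) T)

/-- The self-delimiting unary code `1 ⋯ 1 0` of a natural number. -/
def unary (m : ℕ) : List Bool :=
  List.replicate m true ++ [false]

/-! ### Satisfiability and the Strong Exponential Time Hypothesis -/

/-- A CNF formula over the variables `0, …, numVars - 1`: a list of clauses, each of which is a
list of literals; the literal `(v, true)` is the variable `v`, and `(v, false)` its negation. -/
structure CNF where
  /-- the number of variables -/
  numVars : ℕ
  /-- the clauses -/
  clauses : List (List (Fin numVars × Bool))

namespace CNF

/-- Some truth assignment makes at least one literal of every clause true. -/
def Satisfiable (φ : CNF) : Prop :=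
  ∃ a : Fin φ.numVars → Bool, ∀ C ∈ φ.clauses, ∃ l ∈ C, a l.1 = l.2

/-- All clauses have size at most `k`. -/
def WidthLE (φ : CNF) (k : ℕ) : Prop :=
  ∀ C ∈ φ.clauses, C.length ≤ k

/-- The word of a literal: its sign, then its variable. -/
def encodeLiteral {n : ℕ} (l : Fin n × Bool) : List Bool :=
  l.2 :: unary l.1

/-- The word of a clause: its length, then its literals. -/
def encodeClause {n : ℕ} (C : List (Fin n × Bool)) : List Bool :=
  unary C.length ++ C.flatMap encodeLiteral

/-- The word of a formula: the number of variables, then the clauses. -/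
def encode (φ : CNF) : List Bool :=
  unary φ.numVars ++ φ.clauses.flatMap encodeClause

end CNF

/-- `k`-SAT, the parameter being the number of variables. -/
def kSAT (k : ℕ) : ParamProblem where
  Inst := {φ : CNF // φ.WidthLE k}
  encode φ := φ.1.encode
  param φ := φ.1.numVars
  yes φ := φ.1.Satisfiable

/-- The Strong Exponential Time Hypothesis: for every `ε > 0` there is a `k` such that `k`-SAT on
`n` variables cannot be solved in time `O*((2 - ε) ^ n)`. -/
def SETH : Prop :=
  ∀ ε : ℝ, 0 < ε → ∃ k : ℕ, ¬ SolvableInOStar (kSAT k) (2 - ε)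

/-! ### Caterpillar forests -/

/-- A caterpillar: a tree that contains a path (here the vertices of a walk without repetitions)
such that every vertex outside of the path is adjacent to a vertex of the path. -/
def IsCaterpillar {V : Type*} (T : SimpleGraph V) : Prop :=
  T.IsTree ∧ ∃ (u v : V) (p : T.Walk u v), p.IsPath ∧
    ∀ w : V, w ∉ p.support → ∃ x ∈ p.support, T.Adj w x

/-- A caterpillar forest: a forest all of whose components are caterpillars. -/
def IsCaterpillarForest {V : Type*} (G : SimpleGraph V) : Prop :=
  G.IsAcyclic ∧ ∀ c : G.ConnectedComponent, IsCaterpillar c.toSimpleGraph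

/-- The vertex deletion distance of a finite graph to a caterpillar forest: the least number of
vertices whose deletion leaves a caterpillar forest. -/
noncomputable def caterpillarDist {V : Type*} [Fintype V] (G : SimpleGraph V) : ℕ :=
  sInf {t : ℕ | ∃ S : Finset V, S.card = t ∧ IsCaterpillarForest (G.induce ((S : Set V)ᶜ))}

/-! ### Coloring of triangle-free graphs -/

/-- A finite simple graph on the vertices `0, …, n - 1`, presented by a list of its edges (each
edge occurs at least once, in some orientation). -/
structure GraphInput where
  /-- the number of vertices -/
  n : ℕ
  /-- the graph -/
  graph : SimpleGraph (Fin n)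
  /-- the list of edges -/
  edges : List (Fin n × Fin n)
  /-- the list presents the graph -/
  adj_iff : ∀ u v : Fin n, graph.Adj u v ↔ (u, v) ∈ edges ∨ (v, u) ∈ edges

/-- The word of an edge: its two endpoints. -/
def encodeEdge {n : ℕ} (e : Fin n × Fin n) : List Bool :=
  unary e.1 ++ unary e.2

/-- `q`-Coloring on triangle-free graphs, parameterized by the distance `t` to a caterpillar forest.
As usual for a parameterized problem, the input consists of the graph and of the
value of the parameter: the word lists the number of vertices, the parameter, and the edges. -/
noncomputable def triangleFreeColoring (q : ℕ) : ParamProblem where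
  Inst := {G : GraphInput // G.graph.CliqueFree 3}
  encode G := unary G.1.n ++ unary (caterpillarDist G.1.graph) ++ G.1.edges.flatMap encodeEdge
  param G := caterpillarDist G.1.graph
  yes G := G.1.graph.Colorable q

end FineGrained

/-! The proof is a reduction from `k`-SAT. The `n` variables are cut into blocks of size `β`, and a
block is represented by `p` vertices whose `q ^ p ≥ 2 ^ β` colorings decode onto all assignments of
the block. For a base `b` with `1 ≤ b < q`, suitable `p` and `β` give `b ^ p ≤ x ^ β` for some `x <
2` (`exists_block_sizes`). All modulator vertices together number `t = h + p * (n / β + 1)` with `h`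
independent of the formula, so time `O*(b ^ t)` for coloring becomes time `O*(x ^ n)` for `k`-SAT,
for every `k`. This contradicts SETH.

Colors are named by a triangle-free palette that is uniquely `q`-colorable: the product of `K_q`
with a component of high chromatic number of a shift graph (`exists_palette`). Joining a vertex to
palette vertices forbids the corresponding colors. The palette has two disjoint lists of names, used
alternately along a path; adjacent path vertices then have no common neighbor in the palette, so no
triangle arises.

Outside the modulator there are only paths, the lanes. A lane `F` guesses a block coloring for each
literal position of a clause. The rows along a lane are a separator and the literals for every
clause, and one closing separator. A separator sends out a signal, encoded as color `0`. A literal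
row must pass the signal on if the guess of `F` makes the literal false and agrees with the actual
coloring `y` of the block. The next separator starts with color `0` and so cannot tolerate an
incoming signal. If `y` falsifies a clause, the lane that guesses `y` at all its literals gives a
conflict (`Valid.satisfiable`). If `y` satisfies all clauses, the signal can be stopped in every
lane within every clause (`not_signal_of_satisfies`, `exists_valid`).

The input of the coloring problem contains the exact distance to a caterpillar forest. Each
modulator vertex is therefore put on a private 4-cycle: deleting the modulator leaves disjoint
paths, and every 4-cycle must lose a vertex (`caterpillarDist_eq_card`).

Finally the reduction has to run on a stack machine. It is written in a small counter language, with
a proved step bound (`Spec.exec_prog`), compiled, and composed with the hypothetical machine for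
coloring (`composite_outputs`). -/

namespace FineGrained

/-! ### A small programming language and its compilation to stack machines -/

/-- Programs over a finite register, a one-symbol buffer, an input word, five counters and an
output word to which symbols are prepended. -/
inductive Prog (σ : Type) : Type
  | read : Prog σ
  | inc : Fin 5 → Prog σ
  | dec : Fin 5 → Prog σ
  | emit : Bool → Prog σ
  | set : (Option Bool → σ → σ) → Prog σ
  | seq : Prog σ → Prog σ → Prog σ
  | switch : (σ → Prog σ) → Prog σ
  | whileDo : (Option Bool → σ → Bool) → Prog σ → Prog σ

/-- The states of a program. -/
@[ext]
structure PState (σ : Type) where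
  /-- the buffer that receives the result of reading or decrementing -/
  cur : Option Bool
  /-- the register -/
  reg : σ
  /-- the unread part of the input -/
  inp : List Bool
  /-- the counters -/
  cnt : Fin 5 → ℕ
  /-- the output -/
  out : List Bool

/-- `Exec P s n s'`: started in the state `s`, the program `P` ends in the state `s'` after at
most `n` steps. -/
inductive Exec {σ : Type} : Prog σ → PState σ → ℕ → PState σ → Prop
  | read (s) : Exec .read s 1 { s with cur := s.inp.head?, inp := s.inp.tail }
  | inc (k s) : Exec (.inc k) s 1 { s with cnt := Function.update s.cnt k (s.cnt k + 1) }
  | dec (k s) : Exec (.dec k) s 1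
      { s with
        cur := if s.cnt k = 0 then none else some true
        cnt := Function.update s.cnt k (s.cnt k - 1) }
  | emit (b s) : Exec (.emit b) s 1 { s with out := b :: s.out }
  | set (f s) : Exec (.set f) s 1 { s with reg := f s.cur s.reg }
  | seq {P Q s m s₁ n s₂} : Exec P s m s₁ → Exec Q s₁ n s₂ → Exec (.seq P Q) s (m + n) s₂
  | switch {f s n s'} : Exec (f s.reg) s n s' → Exec (.switch f) s (n + 1) s'
  | while_done {c P s} : c s.cur s.reg = false → Exec (.whileDo c P) s 1 s
  | while_next {c P s m s₁ n s₂} : c s.cur s.reg = true → Exec P s m s₁ →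
      Exec (.whileDo c P) s₁ n s₂ → Exec (.whileDo c P) s (m + n + 1) s₂
  | mono {P s m n s'} : Exec P s m s' → m ≤ n → Exec P s n s'

namespace Prog

/-- The labels of the compiled program. -/
def Label {σ : Type} : Prog σ → Type
  | .seq P Q => P.Label ⊕ Q.Label
  | .switch f => Option (Σ s, (f s).Label)
  | .whileDo _ P => Option P.Label
  | _ => Unit

theorem finite_label {σ : Type} [Finite σ] (P : Prog σ) : Finite P.Label := by
  induction P with
  | seq P Q hP hQ => exact @Finite.instSum _ _ hP hQ
  | switch f hf => exact @instFiniteOption _ (@Finite.instSigma _ _ _ hf)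
  | whileDo _ P hP => exact @instFiniteOption _ hP
  | _ => exact inferInstanceAs (Finite Unit)

/-- The label at which the compiled program starts. -/
def entry {σ : Type} : (P : Prog σ) → P.Label
  | .read | .inc _ | .dec _ | .emit _ | .set _ => ()
  | .seq P _ => .inl P.entry
  | .switch _ | .whileDo _ _ => none

end Prog

/-! ### Simulation of programs by stack machines, and composition with a given machine -/

section Compile

variable {σ : Type} (A : Turing.TM2ComputableAux Bool Bool)

/-- The stacks of the composite machine: the input, the counters, and the stacks of `A`. -/
abbrev CStack : Type := Option (Fin 5) ⊕ A.tm.K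

/-- The stack alphabets of the composite machine. -/
abbrev CAlph : CStack A → Type := Sum.elim (fun _ => Bool) A.tm.Γ

variable (σ) in
/-- The internal states of the composite machine. -/
abbrev CVar : Type := (Option Bool × σ) × A.tm.σ

open Turing.TM2 in
/-- The code of a program: labels are embedded by `emb`, and the program exits to `ex`. -/
def Prog.code {L : Type} : (P : Prog σ) → (P.Label → L) → L → P.Label →
    Stmt (CAlph A) L (CVar σ A)
  | .read, _, ex, _ => .pop (.inl none) (fun v x => ((x, v.1.2), v.2)) (.goto fun _ => ex)
  | .inc k, _, ex, _ => .push (.inl (some k)) (fun _ => true) (.goto fun _ => ex)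
  | .dec k, _, ex, _ => .pop (.inl (some k)) (fun v x => ((x, v.1.2), v.2)) (.goto fun _ => ex)
  | .emit b, _, ex, _ =>
      .push (.inr A.tm.k₀) (fun _ => A.inputAlphabet.symm b) (.goto fun _ => ex)
  | .set f, _, ex, _ => .load (fun v => ((v.1.1, f v.1.1 v.1.2), v.2)) (.goto fun _ => ex)
  | .seq P Q, emb, _, .inl l => P.code (fun x => emb (.inl x)) (emb (.inr Q.entry)) l
  | .seq _ Q, emb, ex, .inr l => Q.code (fun x => emb (.inr x)) ex l
  | .switch f, emb, _, none => .goto fun v => emb (some ⟨v.1.2, (f v.1.2).entry⟩)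
  | .switch f, emb, ex, some ⟨s, l⟩ => (f s).code (fun x => emb (some ⟨s, x⟩)) ex l
  | .whileDo c P, emb, ex, none =>
      .branch (fun v => c v.1.1 v.1.2) (.goto fun _ => emb (some P.entry)) (.goto fun _ => ex)
  | .whileDo _ P, emb, _, some l => P.code (fun x => emb (some x)) (emb none) l

/-- The stacks of the composite machine while it runs a program. -/
def progStk (s : PState σ) : ∀ k, List (CAlph A k)
  | .inl none => s.inp
  | .inl (some k) => List.replicate (s.cnt k) true
  | .inr k => (Turing.initList A.tm (s.out.map A.inputAlphabet.symm)).stk k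

/-- The configuration of the composite machine at a label of a program. -/
def progCfg {L : Type} (l : L) (s : PState σ) (v : A.tm.σ) :
    Turing.TM2.Cfg (CAlph A) L (CVar σ A) :=
  ⟨some l, ((s.cur, s.reg), v), progStk A s⟩

/-- The machine reaches one configuration from another in at most `n` steps. -/
def StepsLE {C : Type*} (f : C → Option C) (n : ℕ) (c c' : C) : Prop :=
  ∃ m ≤ n, (flip bind f)^[m] (some c) = some c'

theorem StepsLE.trans {C : Type*} {f : C → Option C} {m n : ℕ} {a b c : C}
    (h₁ : StepsLE f m a b) (h₂ : StepsLE f n b c) : StepsLE f (m + n) a c := by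
  obtain ⟨m', hm, h₁⟩ := h₁
  obtain ⟨n', hn, h₂⟩ := h₂
  exact ⟨n' + m', by omega, by rw [Function.iterate_add_apply, h₁, h₂]⟩

theorem StepsLE.mono {C : Type*} {f : C → Option C} {m n : ℕ} {a b : C}
    (h : StepsLE f m a b) (hmn : m ≤ n) : StepsLE f n a b :=
  h.imp fun _ h => ⟨h.1.trans hmn, h.2⟩

theorem StepsLE.single {C : Type*} {f : C → Option C} {a b : C} (h : f a = some b) :
    StepsLE f 1 a b :=
  ⟨1, le_rfl, h⟩

theorem initList_stk_self (tm : Turing.FinTM2) (w : List (tm.Γ tm.k₀)) :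
    (Turing.initList tm w).stk tm.k₀ = w := by
  simp [Turing.initList]

theorem initList_stk_of_ne (tm : Turing.FinTM2) (w : List (tm.Γ tm.k₀)) {k : tm.K}
    (h : k ≠ tm.k₀) : (Turing.initList tm w).stk k = [] := by
  simp [Turing.initList, h]

theorem haltList_stk_self (tm : Turing.FinTM2) (w : List (tm.Γ tm.k₁)) :
    (Turing.haltList tm w).stk tm.k₁ = w := by
  simp [Turing.haltList]

theorem haltList_stk_of_ne (tm : Turing.FinTM2) (w : List (tm.Γ tm.k₁)) {k : tm.K}
    (h : k ≠ tm.k₁) : (Turing.haltList tm w).stk k = [] := by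
  simp [Turing.haltList, h]

theorem progStk_read (s : PState σ) (c : Option Bool) :
    Function.update (progStk A s) (.inl none) s.inp.tail =
      progStk A { s with cur := c, inp := s.inp.tail } := by
  funext k
  rcases k with (_ | k) | k <;> simp [progStk, Function.update]

theorem progStk_cnt (s : PState σ) (c : Option Bool) (k : Fin 5) (n : ℕ) :
    Function.update (progStk A s) (.inl (some k)) (List.replicate n true) =
      progStk A { s with cur := c, cnt := Function.update s.cnt k n } := by
  funext k'
  rcases k' with (_ | k') | k'
  · simp [progStk, Function.update]
  · by_cases h : k' = k
    · subst h
      refine (Function.update_self _ _ _).trans ?_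
      simp [progStk]
    · refine (Function.update_of_ne (by simpa using h) _ _).trans ?_
      simp [progStk, h]
  · simp [progStk, Function.update]

theorem progStk_emit (s : PState σ) (b : Bool) :
    Function.update (progStk A s) (.inr A.tm.k₀)
        (A.inputAlphabet.symm b :: progStk A s (.inr A.tm.k₀)) =
      progStk A { s with out := b :: s.out } := by
  funext k
  rcases k with (_ | k) | k
  · exact Function.update_of_ne (by simp) _ _
  · exact Function.update_of_ne (by simp) _ _
  · by_cases h : k = A.tm.k₀
    · subst h
      refine (Function.update_self _ _ _).trans ?_
      simp [progStk, initList_stk_self]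
    · refine (Function.update_of_ne (by simpa using h) _ _).trans ?_
      simp [progStk, h, initList_stk_of_ne]

/-- The compiled program simulates the program. -/
theorem Exec.steps {P : Prog σ} {s s' : PState σ} {n : ℕ} (h : Exec P s n s') {L : Type}
    (M : L → Turing.TM2.Stmt (CAlph A) L (CVar σ A)) (emb : P.Label → L) (ex : L)
    (hM : ∀ l, M (emb l) = P.code A emb ex l) (v : A.tm.σ) :
    StepsLE (Turing.TM2.step M) n (progCfg A (emb P.entry) s v) (progCfg A ex s' v) := by
  induction h generalizing ex with
  | read s =>
    refine .single ?_
    simp only [progCfg, Turing.TM2.step, hM, Prog.code, Turing.TM2.stepAux,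
      ← progStk_read A s s.inp.head?]
    rfl
  | inc k s =>
    refine .single ?_
    simp only [progCfg, Turing.TM2.step, hM, Prog.code, Turing.TM2.stepAux,
      ← progStk_cnt A s s.cur]
    rfl
  | dec k s =>
    refine .single ?_
    simp only [progCfg, Turing.TM2.step, hM, Prog.code, Turing.TM2.stepAux,
      ← progStk_cnt A s (if s.cnt k = 0 then none else some true)]
    simp only [progStk, Option.some.injEq, Turing.TM2.Cfg.mk.injEq,
      Prod.mk.injEq, true_and, and_true]
    cases s.cnt k <;> simp [List.replicate_succ]
  | emit b s =>
    refine .single ?_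
    simp only [progCfg, Turing.TM2.step, hM, Prog.code, Turing.TM2.stepAux, ← progStk_emit]
  | set f s =>
    refine .single ?_
    simp only [progCfg, Turing.TM2.step, hM, Prog.code, Turing.TM2.stepAux]
    rfl
  | @seq P Q s m s₁ n s₂ hP hQ ihP ihQ =>
    exact (ihP (fun x => emb (.inl x)) (emb (.inr Q.entry)) (fun l => hM (.inl l))).trans
      (ihQ (fun x => emb (.inr x)) ex (fun l => hM (.inr l)))
  | @switch f s n s' hf ih =>
    rw [Nat.add_comm]
    refine .trans (.single (b := progCfg A (emb (some ⟨s.reg, (f s.reg).entry⟩)) s v) ?_)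
      (ih (fun x => emb (some ⟨s.reg, x⟩)) ex (fun l => hM (some ⟨s.reg, l⟩)))
    have := hM none
    simp only [progCfg, Turing.TM2.step, Prog.entry, this, Prog.code, Turing.TM2.stepAux]
  | @while_done c P s hc =>
    refine .single ?_
    have := hM none
    simp only [progCfg, Turing.TM2.step, Prog.entry, this, Prog.code, Turing.TM2.stepAux, hc,
      cond_false]
  | @while_next c P s m s₁ n s₂ hc hP hW ihP ihW =>
    rw [Nat.add_comm]
    refine .trans (.single (b := progCfg A (emb (some P.entry)) s v) ?_)
      ((ihP (fun x => emb (some x)) (emb none) (fun l => hM (some l))).trans (ihW emb ex hM))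
    have := hM none
    simp only [progCfg, Turing.TM2.step, Prog.entry, this, Prog.code, Turing.TM2.stepAux, hc,
      cond_true]
  | mono h hmn ih => exact (ih emb ex hM).mono hmn

open Turing.TM2 in
/-- A statement of `A` as a statement of the composite machine. -/
def liftStmt {L : Type} : Stmt A.tm.Γ A.tm.Λ A.tm.σ →
    Stmt (CAlph A) (L ⊕ A.tm.Λ) (CVar σ A)
  | .push k f q => .push (.inr k) (fun v => f v.2) (liftStmt q)
  | .peek k f q => .peek (.inr k) (fun v x => (v.1, f v.2 x)) (liftStmt q)
  | .pop k f q => .pop (.inr k) (fun v x => (v.1, f v.2 x)) (liftStmt q)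
  | .load f q => .load (fun v => (v.1, f v.2)) (liftStmt q)
  | .branch f q₁ q₂ => .branch (fun v => f v.2) (liftStmt q₁) (liftStmt q₂)
  | .goto f => .goto fun v => .inr (f v.2)
  | .halt => .halt

/-- Stacks of `A` as stacks of the composite machine, the others being empty. -/
def liftStk (S : ∀ k, List (A.tm.Γ k)) : ∀ k, List (CAlph A k)
  | .inl _ => []
  | .inr k => S k

/-- A configuration of `A` as a configuration of the composite machine. -/
def liftCfg {L : Type} (r : Option Bool × σ) (c : A.tm.Cfg) :
    Turing.TM2.Cfg (CAlph A) (L ⊕ A.tm.Λ) (CVar σ A) :=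
  ⟨c.l.map .inr, (r, c.var), liftStk A c.stk⟩

theorem liftStk_update (S : ∀ k, List (A.tm.Γ k)) (k : A.tm.K) (w : List (A.tm.Γ k)) :
    Function.update (liftStk A S) (.inr k) w = liftStk A (Function.update S k w) := by
  funext k'
  rcases k' with k' | k'
  · exact Function.update_of_ne (by simp) _ _
  · by_cases h : k' = k
    · subst h
      exact (Function.update_self _ _ _).trans (by simp [liftStk])
    · exact (Function.update_of_ne (by simpa using h) _ _).trans (by simp [liftStk, h])

theorem stepAux_liftStmt {L : Type} (r : Option Bool × σ)
    (q : Turing.TM2.Stmt A.tm.Γ A.tm.Λ A.tm.σ) (v : A.tm.σ) (S : ∀ k, List (A.tm.Γ k)) :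
    Turing.TM2.stepAux (liftStmt (L := L) A q) (r, v) (liftStk A S) =
      liftCfg A r (Turing.TM2.stepAux q v S) := by
  induction q generalizing v S with
  | push k f q ih =>
    simp only [liftStmt, Turing.TM2.stepAux]
    rw [← ih, ← liftStk_update]
    rfl
  | peek k f q ih =>
    simp only [liftStmt, Turing.TM2.stepAux]
    rw [← ih]
    rfl
  | pop k f q ih =>
    simp only [liftStmt, Turing.TM2.stepAux]
    rw [← ih, ← liftStk_update]
    rfl
  | load f q ih =>
    simp only [liftStmt, Turing.TM2.stepAux]
    rw [← ih]
  | branch f q₁ q₂ ih₁ ih₂ =>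
    simp only [liftStmt, Turing.TM2.stepAux]
    cases f v
    · exact ih₂ v S
    · exact ih₁ v S
  | goto f => rfl
  | halt => rfl

variable (σ) in
/-- The composite machine: run the program `P`, then `A` on the output of `P`. -/
noncomputable def composite [Finite σ] (P : Prog σ) (r : σ) : Turing.TM2ComputableAux Bool Bool where
  tm :=
    letI := A.tm.kDecidableEq
    letI := A.tm.kFin
    { K := CStack A
      k₀ := .inl none
      k₁ := .inr A.tm.k₁
      Γ := CAlph A
      Λ := P.Label ⊕ A.tm.Λ
      main := .inl P.entry
      ΛFin :=
        letI := A.tm.ΛFin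
        letI := P.finite_label
        letI := Fintype.ofFinite P.Label
        inferInstance
      σ := CVar σ A
      initialState := ((none, r), A.tm.initialState)
      σFin :=
        letI := A.tm.σFin
        letI := Fintype.ofFinite σ
        inferInstance
      Γk₀Fin := inferInstanceAs (Fintype Bool)
      m := Sum.elim (P.code A .inl (.inr A.tm.main)) (fun l => liftStmt A (A.tm.m l)) }
  inputAlphabet := Equiv.refl Bool
  outputAlphabet := A.outputAlphabet

/-- The initial state of a program. -/
def PState.start (r : σ) (w : List Bool) : PState σ := ⟨none, r, w, 0, []⟩

/-- The final state of a program that cleans up after itself. -/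
def PState.final (r : σ) (o : List Bool) : PState σ := ⟨none, r, [], 0, o⟩

/-- The halting configuration of a machine prescribes the initial internal state and empty stacks
apart from the output. This is why the program has to end in `PState.final`, with its register reset
and its counters and input used up. -/
theorem composite_outputs [Finite σ] {P : Prog σ} {r : σ} {w o : List Bool} {n : ℕ}
    (hP : Exec P (.start r w) n (.final r o)) {T : ℕ} {u : List Bool}
    (hA : Turing.TM2OutputsInTime A.tm (o.map A.inputAlphabet.symm)
      (some (u.map A.outputAlphabet.symm)) T) :
    Nonempty (Turing.TM2OutputsInTime (composite σ A P r).tm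
      (w.map (composite σ A P r).inputAlphabet.symm)
      (some (u.map (composite σ A P r).outputAlphabet.symm)) (n + T)) := by
  set M := composite σ A P r with hM
  have h₁ := hP.steps A M.tm.m .inl (.inr A.tm.main) (fun l => rfl) A.tm.initialState
  have e₁ : (progCfg A (Sum.inl P.entry) (.start r w) A.tm.initialState : M.tm.Cfg) =
      Turing.initList M.tm (w.map M.inputAlphabet.symm) := by
    refine congrArg (Turing.TM2.Cfg.mk _ _) ?_
    funext k
    rcases k with (_ | k) | k
    · exact (List.map_id w).symm.trans (initList_stk_self M.tm _).symm
    · refine .trans ?_ (initList_stk_of_ne M.tm (k := .inl (some k))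
        (w.map M.inputAlphabet.symm) fun h => nomatch Sum.inl.inj h).symm
      simp [progStk, PState.start]
      rfl
    · refine .trans ?_ (initList_stk_of_ne M.tm (k := .inr k)
        (w.map M.inputAlphabet.symm) fun h => nomatch h).symm
      by_cases h : k = A.tm.k₀
      · subst h
        simp [progStk, PState.start, initList_stk_self]
        rfl
      · simp [progStk, PState.start, initList_stk_of_ne, h]
        rfl
  -- The output stack of the program is the input stack of `A`, and the internal state of `A` is
  -- untouched so far; hence the program exits exactly in the initial configuration of `A`.
  have e₂ : (progCfg A (Sum.inr A.tm.main) (.final r o) A.tm.initialState : M.tm.Cfg) =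
      liftCfg A (none, r) (Turing.initList A.tm (o.map A.inputAlphabet.symm)) := by
    refine congrArg (Turing.TM2.Cfg.mk _ _) ?_
    funext k
    rcases k with (_ | k) | k <;> simp [progStk, PState.final, liftStk]
  have e₃ : (liftCfg A (none, r) (Turing.haltList A.tm (u.map A.outputAlphabet.symm)) : M.tm.Cfg)
      = Turing.haltList M.tm (u.map M.outputAlphabet.symm) := by
    refine congrArg (Turing.TM2.Cfg.mk _ _) ?_
    funext k
    rcases k with k | k
    · exact (haltList_stk_of_ne M.tm (k := .inl k)
        (u.map M.outputAlphabet.symm) fun h => nomatch h).symm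
    · by_cases h : k = A.tm.k₁
      · subst h
        exact (haltList_stk_self A.tm _).trans (haltList_stk_self M.tm _).symm
      · exact (haltList_stk_of_ne A.tm _ h).trans
          (haltList_stk_of_ne M.tm (k := .inr k)
            (u.map M.outputAlphabet.symm) fun e => h (Sum.inr.inj e)).symm
  have hstep : ∀ c : Option A.tm.Cfg,
      flip bind M.tm.step (c.map (liftCfg A (none, r))) =
        (flip bind A.tm.step c).map (liftCfg A (none, r)) := by
    rintro (_ | ⟨_ | l, v, S⟩)
    · rfl
    · rfl
    · exact congrArg some (stepAux_liftStmt A (none, r) (A.tm.m l) v S)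
  have h₂ : StepsLE M.tm.step T
      (liftCfg A (none, r) (Turing.initList A.tm (o.map A.inputAlphabet.symm)))
      (liftCfg A (none, r) (Turing.haltList A.tm (u.map A.outputAlphabet.symm))) := by
    obtain ⟨⟨m, hm⟩, hmT⟩ := hA
    refine ⟨m, hmT, ?_⟩
    have := Function.Semiconj.iterate_right (f := Option.map (liftCfg A (none, r)))
      (ga := flip bind A.tm.step) (gb := flip bind M.tm.step) (fun c => (hstep c).symm) m
    have := this (some (Turing.initList A.tm (o.map A.inputAlphabet.symm)))
    rw [hm] at this
    exact this.symm
  rw [← e₂] at h₂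
  obtain ⟨m, hm, h⟩ := StepsLE.trans h₁ h₂
  rw [e₁, e₃] at h
  exact ⟨⟨⟨m, h⟩, hm⟩⟩

end Compile

end FineGrained

namespace FineGrained

/-! ### Derived programs -/

namespace Prog

variable {σ : Type}

/-- The program that does nothing. -/
def skip : Prog σ := .set fun _ r => r

/-- Repeat a program a fixed number of times. -/
def rep : ℕ → Prog σ → Prog σ
  | 0, _ => skip
  | n + 1, P => .seq (rep n P) P

/-- Count a counter down to zero, running a program after each step. -/
def loop (k : Fin 5) (P : Prog σ) : Prog σ :=
  .seq (.dec k) (.whileDo (fun x _ => x.isSome) (.seq P (.dec k)))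

/-- Run a program for each symbol `true` in the buffer and on the input, up to the first other
symbol. -/
def unaryLoop (P : Prog σ) : Prog σ :=
  .whileDo (fun x _ => x == some true) (.seq P .read)

/-- Output the `m`-fold of a counter in unary; counter `3` is used for restoring it. -/
def copy (k : Fin 5) (m : ℕ) : Prog σ :=
  .seq (loop k (.seq (rep m (.emit true)) (.inc 3))) (loop 3 (.inc k))

end Prog

open Prog

variable {σ : Type}

theorem Exec.to {P : Prog σ} {s s' t : PState σ} {m n : ℕ} (h : Exec P s m s') (hs : s' = t)
    (hmn : m ≤ n) : Exec P s n t :=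
  hs ▸ h.mono hmn

theorem Exec.startEq {P : Prog σ} {s s' t : PState σ} {n : ℕ} (h : Exec P s n s') (hs : t = s) :
    Exec P t n s' :=
  hs ▸ h

theorem exec_skip (s : PState σ) : Exec skip s 1 s := .set _ s

theorem exec_rep {P : Prog σ} {m : ℕ} (n : ℕ) (f : ℕ → PState σ)
    (h : ∀ i < n, Exec P (f i) m (f (i + 1))) : Exec (rep n P) (f 0) (n * m + 1) (f n) := by
  induction n with
  | zero => exact (exec_skip (f 0)).mono (by omega)
  | succ n ih =>
    exact ((ih fun i hi => h i (by omega)).seq (h n (by omega))).mono (by linarith)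

theorem exec_rep_inc (k : Fin 5) (n : ℕ) (s : PState σ) :
    Exec (rep n (.inc k)) s (n + 1) { s with cnt := Function.update s.cnt k (s.cnt k + n) } := by
  have := exec_rep (P := .inc k) (m := 1) n
    (fun i => { s with cnt := Function.update s.cnt k (s.cnt k + i) }) fun i _ => by
      convert Exec.inc k _ using 2
      simp [add_assoc]
  simpa using this

theorem exec_rep_emit (n : ℕ) (s : PState σ) :
    Exec (rep n (.emit true)) s (n + 1) { s with out := List.replicate n true ++ s.out } := by
  have := exec_rep (P := .emit true) (m := 1) n
    (fun i => { s with out := List.replicate i true ++ s.out }) fun i _ => by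
      exact Exec.emit true _
  simpa using this

/-- The state `f i` is the one in which the counter still shows `i`, so the loop runs from `f n`
down to `f 0`. The body starts after the decrement, with `some true` in the buffer. -/
theorem exec_loop {P : Prog σ} {k : Fin 5} {m : ℕ} (n : ℕ) (f : ℕ → PState σ)
    (hf : ∀ i ≤ n, (f i).cnt k = i)
    (h : ∀ i < n, Exec P { f (i + 1) with
      cur := some true, cnt := Function.update (f (i + 1)).cnt k i } m (f i)) :
    Exec (loop k P) (f n) (n * (m + 2) + 2) { f 0 with cur := none } := by
  have key : ∀ j ≤ n, Exec (.whileDo (fun x _ => x.isSome) (.seq P (.dec k)))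
      { f j with
        cur := if j = 0 then none else some true
        cnt := Function.update (f j).cnt k (j - 1) } (j * (m + 2) + 1)
      { f 0 with cur := none } := by
    intro j hj
    induction j with
    | zero =>
      rw [show Function.update (f 0).cnt k (0 - 1) = (f 0).cnt from
        Function.update_eq_self_iff.2 (hf 0 hj).symm]
      exact (Exec.while_done rfl).mono (by omega)
    | succ j ih =>
      have h₁ := h j hj
      have h₂ := Exec.dec k (f j)
      rw [hf j (by omega)] at h₂
      exact (Exec.while_next rfl (h₁.seq h₂) (ih (by omega))).mono (by linarith)
  have h₂ := Exec.dec k (f n)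
  rw [hf n le_rfl] at h₂
  exact (h₂.seq (key n le_rfl)).mono (by omega)

theorem exec_unaryLoop {P : Prog σ} {m : ℕ} (n : ℕ) (f : ℕ → PState σ) (w : List Bool)
    (h : ∀ i < n, ∀ v, Exec P { f i with cur := some true, inp := v } m
      { f (i + 1) with cur := some true, inp := v }) :
    Exec (unaryLoop P)
      { f 0 with cur := (unary n ++ w).head?, inp := (unary n ++ w).tail } (n * (m + 2) + 1)
      { f n with cur := some false, inp := w } := by
  induction n generalizing f with
  | zero => exact (Exec.while_done rfl).mono (by omega)
  | succ n ih =>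
    have h₁ := h 0 (by omega) (unary n ++ w)
    have h₂ := ih (fun i => f (i + 1)) fun i hi => h (i + 1) (by omega)
    have h₃ := Exec.read { f 1 with cur := some true, inp := unary n ++ w }
    exact (Exec.while_next rfl (h₁.seq h₃) h₂).mono (by linarith)

/-- The counter is moved to counter `3` while the output is written, and then moved back; both
families of states record how far the transfer has come. -/
theorem exec_copy {k : Fin 5} (hk : k ≠ 3) (m : ℕ) (s : PState σ) (hs : s.cnt 3 = 0) :
    Exec (copy k m) s ((m + 7) * (s.cnt k) + 4)
      { s with cur := none, out := List.replicate (m * s.cnt k) true ++ s.out } := by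
  have h₁ := exec_loop (P := .seq (rep m (.emit true)) (.inc 3)) (k := k) (m := m + 2) (s.cnt k)
    (fun i => { s with
      cur := if i = s.cnt k then s.cur else some true
      cnt := Function.update (Function.update s.cnt k i) 3 (s.cnt k - i)
      out := List.replicate (m * (s.cnt k - i)) true ++ s.out })
    (fun i _ => by simp [hk]) fun i hi => by
      convert (exec_rep_emit m _).seq (.inc 3 _) using 2
      · simp [hi.ne]
      · funext j
        have : s.cnt k - i = s.cnt k - (i + 1) + 1 := by omega
        by_cases h3 : j = 3
        · subst h3
          simp [Function.update, hk.symm, this]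
        · by_cases hj : j = k <;> simp [Function.update, h3, hj, hk]
      · have : s.cnt k - i = s.cnt k - (i + 1) + 1 := by omega
        simp only [this, ← List.append_assoc, ← List.replicate_add]
        ring_nf
  have h₂ := exec_loop (P := .inc k) (k := 3) (m := 1) (s.cnt k)
    (fun i => { s with
      cur := if i = s.cnt k then none else some true
      cnt := Function.update (Function.update s.cnt k (s.cnt k - i)) 3 i
      out := List.replicate (m * s.cnt k) true ++ s.out })
    (fun i _ => by simp) fun i hi => by
      convert Exec.inc k _ using 2
      · simp [hi.ne]
      · funext j
        have : s.cnt k - i = s.cnt k - (i + 1) + 1 := by omega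
        by_cases h3 : j = 3
        · subst h3
          simp [Function.update, hk.symm]
        · by_cases hj : j = k <;> simp [Function.update, h3, hj, hk, this]
  have e₀ : Function.update s.cnt 3 0 = s.cnt := by simp [← hs]
  simp only [Nat.sub_self, Function.update_eq_self, e₀, if_true] at h₁ h₂
  exact (Exec.seq (by simpa [e₀] using h₁) (by simpa [e₀] using h₂)).to rfl (by linarith)

/-! ### Output of edges -/

/-- A linear expression in the values of the counters `0` and `1`. -/
abbrev Term : Type := ℕ × ℕ × ℕ

/-- The value of a linear expression. -/
def Term.val (c b : ℕ) (τ : Term) : ℕ := τ.1 + τ.2.1 * c + τ.2.2 * b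

/-- The word of a list of edges. -/
def encEdges (l : List (ℕ × ℕ)) : List Bool := l.flatMap fun e => unary e.1 ++ unary e.2

theorem encEdges_append (l l' : List (ℕ × ℕ)) : encEdges (l ++ l') = encEdges l ++ encEdges l' := by
  simp [encEdges]

/-- The edges that a list of pairs of linear expressions describes. -/
def edgesAt (c b : ℕ) (l : List (Term × Term)) : List (ℕ × ℕ) :=
  l.map fun e => (Term.val c b e.1, Term.val c b e.2)

/-- Output the unary code of a linear expression. -/
def emitTerm (τ : Term) : Prog σ :=
  -- Symbols are prepended to the output, so the terminating `false` of the code is written before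
  -- the `true`s.
  .seq (.emit false) (.seq (rep τ.1 (.emit true)) (.seq (copy 0 τ.2.1) (copy 1 τ.2.2)))

/-- Output a list of edges. -/
def emitEdges : List (Term × Term) → Prog σ
  -- Counter `3` is zero here, so this only clears the buffer; the state after an empty list then
  -- has the same form as after a nonempty one.
  | [] => .dec 3
  | e :: l => .seq (emitEdges l) (.seq (emitTerm e.2) (emitTerm e.1))

theorem exec_emitTerm (τ : Term) (s : PState σ) (hs : s.cnt 3 = 0) :
    Exec (emitTerm τ) s ((τ.1 + τ.2.1 + τ.2.2 + 10) * (s.cnt 0 + s.cnt 1 + 1))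
      { s with cur := none, out := unary (τ.val (s.cnt 0) (s.cnt 1)) ++ s.out } := by
  have h₁ := Exec.emit false s
  have h₂ := exec_rep_emit τ.1 { s with out := false :: s.out }
  have h₃ := exec_copy (k := 0) (by decide) τ.2.1
    { s with out := List.replicate τ.1 true ++ false :: s.out } hs
  have h₄ := exec_copy (k := 1) (by decide) τ.2.2
    { s with
      cur := none
      out := List.replicate (τ.2.1 * s.cnt 0) true ++
        (List.replicate τ.1 true ++ false :: s.out) } hs
  refine (h₁.seq (h₂.seq (h₃.seq h₄))).to ?_ ?_
  · ext1 <;> try rfl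
    simp only [Term.val, unary, ← List.append_assoc, ← List.replicate_add]
    rw [List.append_assoc _ [false], List.singleton_append]
    congr 2
    ring
  · dsimp only
    generalize s.cnt 0 = x
    generalize s.cnt 1 = y
    nlinarith [Nat.zero_le (τ.1 * x), Nat.zero_le (τ.1 * y), Nat.zero_le (τ.2.1 * y),
      Nat.zero_le (τ.2.2 * x)]

theorem exec_emitEdges (l : List (Term × Term)) : ∃ K : ℕ, ∀ s : PState σ, s.cnt 3 = 0 →
    Exec (emitEdges l) s (K * (s.cnt 0 + s.cnt 1 + 1))
      { s with cur := none, out := encEdges (edgesAt (s.cnt 0) (s.cnt 1) l) ++ s.out } := by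
  induction l with
  | nil =>
    refine ⟨1, fun s hs => (Exec.dec 3 s).to ?_ (by omega)⟩
    ext1 <;> try rfl
    · simp [hs]
    · exact Function.update_eq_self_iff.2 (by simp [hs])
  | cons e l ih =>
    obtain ⟨K, ih⟩ := ih
    refine ⟨K + (e.2.1 + e.2.2.1 + e.2.2.2 + 10) + (e.1.1 + e.1.2.1 + e.1.2.2 + 10),
      fun s hs => ?_⟩
    have h₁ := ih s hs
    have h₂ := exec_emitTerm e.2 { s with
      cur := none, out := encEdges (edgesAt (s.cnt 0) (s.cnt 1) l) ++ s.out } hs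
    have h₃ := exec_emitTerm e.1 { s with
      cur := none
      out := unary (e.2.val (s.cnt 0) (s.cnt 1)) ++
        (encEdges (edgesAt (s.cnt 0) (s.cnt 1) l) ++ s.out) } hs
    refine (h₁.seq (h₂.seq h₃)).to ?_ (le_of_eq ?_)
    · simp [edgesAt, encEdges]
    · dsimp only
      ring

end FineGrained

namespace FineGrained

open Prog

/-! ### The reduction as a program -/

/-- The finite register of the reduction: the sign of a literal, the offset of its variable in its
block, and the number of literals of the clause still to be read. -/
abbrev Reg (β k : ℕ) : Type := Bool × Fin β × Fin (k + 1)

/-- The constants of the reduction: variables come in blocks of size `β`, each represented by `p`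
vertices; clauses have size at most `k`; the fixed part of the graph has `h` vertices and the edges
`fixed`; a row of the graph has `D` vertices and the edges `row`, where `none` stands for a
separator and `some` for a literal. -/
structure Spec where
  /-- size of a block of variables -/
  β : ℕ
  /-- number of vertices that represent a block -/
  p : ℕ
  /-- width of the formula -/
  k : ℕ
  /-- number of fixed modulator vertices -/
  h : ℕ
  /-- number of vertices of a row -/
  D : ℕ
  /-- edges of the fixed part -/
  fixed : List (ℕ × ℕ)
  /-- edges of a row -/
  row : Option (Reg β k) → List (Term × Term)
  β_pos : 0 < β

namespace Spec

variable (R : Spec)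

/-- The edges of a 4-cycle through the vertex that counter `0` points at. -/
def square : List (Term × Term) :=
  [((0, 1, 0), (1, 1, 0)), ((1, 1, 0), (2, 1, 0)), ((2, 1, 0), (3, 1, 0)), ((3, 1, 0), (0, 1, 0))]

/-- A variable index modulo the block size. -/
def offset (n : ℕ) : Fin R.β := ⟨n % R.β, Nat.mod_lt _ R.β_pos⟩

/-- A number, capped at `k`. -/
def cap (n : ℕ) : Fin (R.k + 1) := ⟨min n R.k, by omega⟩

/-- The register at the start of a phase. -/
def reg (b : Bool) (n m : ℕ) : Reg R.β R.k := (b, R.offset n, R.cap m)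

/-- Count a variable index up by one. -/
def countVar : Prog (Reg R.β R.k) :=
  .seq (.switch fun r => if r.2.1.val + 1 = R.β then .inc 1 else skip)
    (.set fun _ r => (r.1, R.offset (r.2.1 + 1), r.2.2))

/-- Read a unary number `v` and split it into the block `v / β` and the offset `v % β`. -/
def readVar : Prog (Reg R.β R.k) := .seq .read (unaryLoop R.countVar)

/-- Output the edges of a row and advance to the next row. -/
def emitRow (κ : Option (Reg R.β R.k)) : Prog (Reg R.β R.k) :=
  .seq (emitEdges (R.row κ)) (rep R.D (.inc 0))

/-- Process a literal. -/
def literal : Prog (Reg R.β R.k) :=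
  .seq .read (.seq (.set fun x r => (x.getD false, r.2)) (.seq R.readVar
    (.seq (.switch fun r => R.emitRow (some r)) (.seq (loop 1 skip)
      (.set fun _ r => (r.1, R.offset 0, R.cap (r.2.2 - 1)))))))

/-- Process the clauses. -/
def clauseLoop : Prog (Reg R.β R.k) :=
  -- The buffer already holds the first symbol of the next clause, and is `none` at the end of the
  -- input. The length of the clause goes to the register, where it is counted down as literals are
  -- read.
  .whileDo (fun x _ => x.isSome) (.seq
    (unaryLoop (.set fun _ r => (r.1, r.2.1, R.cap (r.2.2 + 1))))
    (.seq (R.emitRow none) (.seq (.whileDo (fun _ r => r.2.2.val ≠ 0) R.literal) .read)))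

/-- Set up the modulator. -/
def header : Prog (Reg R.β R.k) :=
  -- Counter `2` becomes `h + p * (n / β) + p`, the size of the modulator. The loop that writes the
  -- 4-cycles uses it up, so counter `4` keeps a copy from which it is restored.
  .seq R.readVar (.seq (.set fun _ r => (r.1, R.offset 0, r.2.2)) (.seq
    (loop 1 (rep R.p (.inc 2))) (.seq (rep (R.h + R.p) (.inc 2)) (.seq
      (loop 2 (.seq (.inc 4) (.seq (emitEdges square) (rep 4 (.inc 0)))))
      (.seq (loop 4 (.inc 2))
        (emitEdges (R.fixed.map fun e => ((e.1, 0, 0), (e.2, 0, 0)))))))))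

/-- Output the number of vertices and the parameter, and clean up. -/
def trailer : Prog (Reg R.β R.k) :=
  -- The second increment by `D` accounts for the initial row, which precedes all rows of the
  -- formula. The number of vertices is known only now; since output is prepended, it still comes
  -- first in the word.
  .seq (R.emitRow none) (.seq (rep R.D (.inc 0)) (.seq (.emit false) (.seq (loop 2 (.emit true))
    (.seq (.emit false) (.seq (loop 0 (.emit true))
      (.set fun _ _ => R.reg false 0 0))))))

/-- The reduction. -/
def prog : Prog (Reg R.β R.k) := .seq R.header (.seq .read (.seq R.clauseLoop R.trailer))

/-! ### The output of the reduction -/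

/-- The content of a row: what it stands for, and the block of its variable. -/
abbrev Row : Type := Option (Reg R.β R.k) × ℕ

/-- The rows of a list of literals. -/
def litRows {n : ℕ} : List (Fin n × Bool) → List R.Row
  | [] => []
  | l :: ls => (some (R.reg l.2 l.1 (ls.length + 1)), l.1 / R.β) :: litRows ls

/-- The rows of a list of clauses. -/
def clauseRows {n : ℕ} (cs : List (List (Fin n × Bool))) : List R.Row :=
  cs.flatMap fun c => (none, 0) :: R.litRows c

/-- The rows of a formula. -/
def rows (φ : CNF) : List R.Row := R.clauseRows φ.clauses ++ [(none, 0)]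

/-- The edges of rows, the first of which starts at `c`; later rows come first. -/
def rowEdges : ℕ → List R.Row → List (ℕ × ℕ)
  | _, [] => []
  | c, r :: rs => rowEdges (c + R.D) rs ++ edgesAt c r.2 (R.row r.1)

/-- The size of the modulator. -/
def modSize (φ : CNF) : ℕ := R.h + R.p * (φ.numVars / R.β + 1)

/-- The edges of the 4-cycles, later ones first. -/
def squares : ℕ → List (ℕ × ℕ)
  | 0 => []
  | t + 1 => edgesAt (4 * t) 0 square ++ squares t

/-- All edges of the graph. -/
def edgeList (φ : CNF) : List (ℕ × ℕ) :=
  R.rowEdges (4 * R.modSize φ) (R.rows φ) ++ (R.fixed ++ squares (R.modSize φ))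

/-- The number of vertices of the graph. -/
def order (φ : CNF) : ℕ := 4 * R.modSize φ + R.D * ((R.rows φ).length + 1)

/-- The output of the reduction. -/
def output (φ : CNF) : List Bool :=
  unary (R.order φ) ++ unary (R.modSize φ) ++ encEdges (R.edgeList φ)

theorem rowEdges_append (c : ℕ) (l l' : List R.Row) :
    R.rowEdges c (l ++ l') = R.rowEdges (c + R.D * l.length) l' ++ R.rowEdges c l := by
  induction l generalizing c with
  | nil => simp [rowEdges]
  | cons r l ih => simp [rowEdges, ih, mul_add, add_assoc, add_comm]

theorem mem_rowEdges {c : ℕ} {l : List R.Row} {e : ℕ × ℕ} :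
    e ∈ R.rowEdges c l ↔ ∃ i : Fin l.length,
      e ∈ edgesAt (c + R.D * i) (l.get i).2 (R.row (l.get i).1) := by
  induction l generalizing c with
  | nil => simp [rowEdges]
  | cons r l ih =>
    rw [rowEdges, List.mem_append, ih]
    simp [Fin.exists_fin_succ, mul_add, add_assoc, add_comm, or_comm]

theorem mem_squares {t : ℕ} {e : ℕ × ℕ} :
    e ∈ squares t ↔ ∃ s < t, e ∈ edgesAt (4 * s) 0 square := by
  induction t with
  | zero => simp [squares]
  | succ t ih =>
    rw [squares, List.mem_append, ih]
    simp only [Nat.lt_succ_iff_lt_or_eq, or_and_right, exists_or, exists_eq_left, or_comm]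

/-! ### Correctness and running time of the program -/

/-- A state of the program. -/
abbrev st (x : Option Bool) (r : Reg R.β R.k) (w : List Bool) (a b c d e : ℕ) (o : List Bool) :
    PState (Reg R.β R.k) := ⟨x, r, w, ![a, b, c, d, e], o⟩

variable {R}

/-- Invariant of reading a variable `n`: the register holds `n % β` and counter `1` holds `n / β`.
The counter advances exactly when the offset wraps around. -/
theorem exec_countVar (x) (s : Bool) (m n : ℕ) (w a c d e o) :
    Exec R.countVar (R.st x (R.reg s n m) w a (n / R.β) c d e o) 3
      (R.st x (R.reg s (n + 1) m) w a ((n + 1) / R.β) c d e o) := by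
  have hβ := R.β_pos
  have ho : R.offset (n % R.β + 1) = R.offset (n + 1) := by simp [offset]
  have hd : R.β ∣ n + 1 ↔ n % R.β + 1 = R.β := by
    have h₁ := Nat.mod_lt n hβ
    rw [Nat.dvd_iff_mod_eq_zero, Nat.add_mod]
    constructor
    · intro h
      rcases Nat.lt_or_ge 1 R.β with h1 | h1
      · rw [Nat.mod_eq_of_lt h1] at h
        by_contra hne
        rw [Nat.mod_eq_of_lt (by omega)] at h
        omega
      · omega
    · intro h
      rw [← Nat.add_mod, ← Nat.mod_add_mod, h, Nat.mod_self]
  by_cases h : n % R.β + 1 = R.β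
  · refine Exec.to (s' := R.st x (R.reg s (n + 1) m) w a (n / R.β + 1) c d e o) (.seq (.switch
      (s' := R.st x (R.reg s n m) w a (n / R.β + 1) c d e o) (n := 1) ?_) ?_) ?_
      (show (1 + 1) + 1 ≤ 3 by omega)
    · have h' : (R.st x (R.reg s n m) w a (n / R.β) c d e o).reg.2.1.val + 1 = R.β := h
      simp only [h', if_true]
      refine (Exec.inc 1 _).to ?_ le_rfl
      ext1 <;> try rfl
      funext i
      fin_cases i <;> rfl
    · refine (Exec.set _ _).to ?_ le_rfl
      ext1 <;> try rfl
      exact Prod.ext rfl (Prod.ext ho rfl)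
    · rw [Nat.succ_div, if_pos (hd.2 h)]
  · refine Exec.to (s' := R.st x (R.reg s (n + 1) m) w a (n / R.β) c d e o) (.seq (.switch
      (s' := R.st x (R.reg s n m) w a (n / R.β) c d e o) (n := 1) ?_) ?_) ?_
      (show (1 + 1) + 1 ≤ 3 by omega)
    · have h' : ¬ (R.st x (R.reg s n m) w a (n / R.β) c d e o).reg.2.1.val + 1 = R.β := h
      simp only [h', if_false]
      exact exec_skip _
    · refine (Exec.set _ _).to ?_ le_rfl
      ext1 <;> try rfl
      exact Prod.ext rfl (Prod.ext ho rfl)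
    · rw [Nat.succ_div, if_neg (fun h' => h (hd.1 h')), add_zero]

theorem exec_readVar (x) (s : Bool) (m n : ℕ) (w a c d e o) :
    Exec R.readVar (R.st x (R.reg s 0 m) (unary n ++ w) a 0 c d e o) (n * 5 + 2)
      (R.st (some false) (R.reg s n m) w a (n / R.β) c d e o) := by
  have h := exec_unaryLoop (P := R.countVar) (m := 3) n
    (fun i => R.st x (R.reg s i m) w a (i / R.β) c d e o) w
    fun i _ v => exec_countVar _ _ _ _ _ _ _ _ _ _
  refine ((Exec.read _).seq ?_).to rfl (show 1 + (n * (3 + 2) + 1) ≤ n * 5 + 2 by omega)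
  simpa using h

/-- There are finitely many row contents `κ`, so the sum of their constants serves for all of them.
-/
theorem exec_emitRow (R : Spec) : ∃ K : ℕ, ∀ κ x r w a b c e o,
    Exec (R.emitRow κ) (R.st x r w a b c 0 e o) (K * (a + b + 1))
      (R.st none r w (a + R.D) b c 0 e (encEdges (edgesAt a b (R.row κ)) ++ o)) := by
  choose K hK using fun κ => exec_emitEdges (σ := Reg R.β R.k) (R.row κ)
  refine ⟨(∑ κ, K κ) + (R.D + 1), fun κ x r w a b c e o => ?_⟩
  have h₁ := hK κ (R.st x r w a b c 0 e o) rfl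
  have h₂ := exec_rep_inc 0 R.D
    (R.st none r w a b c 0 e (encEdges (edgesAt a b (R.row κ)) ++ o))
  refine (h₁.seq h₂).to ?_ ?_
  · ext1 <;> try rfl
    funext i
    fin_cases i <;> rfl
  · have := Finset.single_le_sum (f := K) (fun _ _ => Nat.zero_le _) (Finset.mem_univ κ)
    have : K κ * (a + b + 1) ≤ (∑ κ, K κ) * (a + b + 1) := Nat.mul_le_mul_right _ this
    change K κ * (a + b + 1) + (R.D + 1) ≤ _
    nlinarith

end Spec

end FineGrained

/-! ### Step bounds for the loops of the reduction -/

namespace FineGrained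

open Prog

namespace Spec

variable {R : Spec}

theorem exec_loop_skip (x r w a b c d e o) :
    Exec (loop 1 skip) (R.st x r w a b c d e o) (b * 3 + 2) (R.st none r w a 0 c d e o) := by
  have := exec_loop (P := skip) (k := 1) (m := 1) b
    (fun i => R.st (if i = b then x else some true) r w a i c d e o) (fun i _ => rfl)
    fun i hi => by
      refine (exec_skip _).to ?_ le_rfl
      ext1 <;> try rfl
      · simp [hi.ne]
      · funext j
        fin_cases j <;> rfl
  simpa using this

theorem exec_literal (R : Spec) : ∃ K : ℕ, ∀ (M : ℕ) (x : Option Bool) (s : Bool) {n : ℕ}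
    (l : Fin n × Bool) (m : ℕ) (w a c e o), m + 1 ≤ R.k → a ≤ M → l.1.val ≤ M →
    Exec R.literal (R.st x (R.reg s 0 (m + 1)) (CNF.encodeLiteral l ++ w) a 0 c 0 e o)
      (K * (M + 1))
      (R.st none (R.reg l.2 0 m) w (a + R.D) 0 c 0 e
        (encEdges (edgesAt a (l.1 / R.β) (R.row (some (R.reg l.2 l.1 (m + 1))))) ++ o)) := by
  obtain ⟨K, hK⟩ := exec_emitRow R
  refine ⟨2 * K + 12, fun M x s n l m w a c e o hm ha hl => ?_⟩
  set b := l.1.val / R.β with hb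
  set o' := encEdges (edgesAt a b (R.row (some (R.reg l.2 l.1 (m + 1))))) ++ o with ho'
  have h₁ : Exec .read (R.st x (R.reg s 0 (m + 1)) (CNF.encodeLiteral l ++ w) a 0 c 0 e o) 1
      (R.st (some l.2) (R.reg s 0 (m + 1)) (unary l.1 ++ w) a 0 c 0 e o) := Exec.read _
  have h₂ : Exec (.set fun x r => (x.getD false, r.2))
      (R.st (some l.2) (R.reg s 0 (m + 1)) (unary l.1 ++ w) a 0 c 0 e o) 1
      (R.st (some l.2) (R.reg l.2 0 (m + 1)) (unary l.1 ++ w) a 0 c 0 e o) := Exec.set _ _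
  have h₃ := exec_readVar (R := R) (some l.2) l.2 (m + 1) l.1 w a c 0 e o
  have h₄ : Exec (.switch fun r => R.emitRow (some r))
      (R.st (some false) (R.reg l.2 l.1 (m + 1)) w a b c 0 e o) (K * (a + b + 1) + 1)
      (R.st none (R.reg l.2 l.1 (m + 1)) w (a + R.D) b c 0 e o') :=
    .switch (hK (some (R.reg l.2 l.1 (m + 1))) _ _ _ _ _ _ _ _)
  have h₅ := exec_loop_skip (R := R) none (R.reg l.2 l.1 (m + 1)) w (a + R.D) b c 0 e o'
  have h₆ : Exec (.set fun _ r => (r.1, R.offset 0, R.cap (r.2.2 - 1)))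
      (R.st none (R.reg l.2 l.1 (m + 1)) w (a + R.D) 0 c 0 e o') 1
      (R.st none (R.reg l.2 0 m) w (a + R.D) 0 c 0 e o') := by
    refine (Exec.set _ _).to ?_ le_rfl
    ext1 <;> try rfl
    have : R.cap (R.cap (m + 1) - 1) = R.cap m := by simp [cap, hm]
    simp only [reg, this]
  have hbM : b ≤ M := (Nat.div_le_self _ _).trans hl
  refine (h₁.seq (h₂.seq (h₃.seq (h₄.seq (h₅.seq h₆))))).to rfl ?_
  nlinarith [Nat.mul_le_mul_left K ha, Nat.mul_le_mul_left K hbM]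

theorem exec_literals (R : Spec) : ∃ K : ℕ, ∀ (M : ℕ) {n : ℕ} (ls : List (Fin n × Bool))
    (x : Option Bool) (s : Bool) (w a c e o), ls.length ≤ R.k → a + R.D * ls.length ≤ M →
    (∀ l ∈ ls, l.1.val ≤ M) → ∃ x' s',
    Exec (.whileDo (fun _ r => r.2.2.val ≠ 0) R.literal)
      (R.st x (R.reg s 0 ls.length) (ls.flatMap CNF.encodeLiteral ++ w) a 0 c 0 e o)
      (K * (M + 1) * ls.length + 1)
      (R.st x' (R.reg s' 0 0) w (a + R.D * ls.length) 0 c 0 e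
        (encEdges (R.rowEdges a (R.litRows ls)) ++ o)) := by
  obtain ⟨K, hK⟩ := exec_literal R
  refine ⟨K + 1, fun M n ls => ?_⟩
  induction ls with
  | nil =>
    intro x s w a c e o _ _ _
    exact ⟨x, s, (Exec.while_done (by simp [reg, cap])).mono (by simp)⟩
  | cons l ls ih =>
    intro x s w a c e o hk ha hl
    rw [List.length_cons] at hk ha
    have h₁ := hK M x s l ls.length (ls.flatMap CNF.encodeLiteral ++ w) a c e o hk (by nlinarith)
      (hl l (by simp))
    obtain ⟨x', s', h₂⟩ := ih none l.2 w (a + R.D) c e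
      (encEdges (edgesAt a (l.1 / R.β) (R.row (some (R.reg l.2 l.1 (ls.length + 1))))) ++ o)
      (by omega) (by linarith) (fun l' h => hl l' (by simp [h]))
    refine ⟨x', s', ?_⟩
    rw [List.flatMap_cons, List.append_assoc, List.length_cons]
    refine (Exec.while_next ?_ h₁ h₂).to ?_ ?_
    · simp only [reg, cap]
      simp
      omega
    · simp only [litRows, rowEdges, encEdges_append, List.append_assoc]
      rw [show a + R.D * (ls.length + 1) = a + R.D + R.D * ls.length by ring]
    · nlinarith

theorem length_le_length_flatMap_encodeLiteral {n : ℕ} (ls : List (Fin n × Bool)) :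
    ls.length ≤ (ls.flatMap CNF.encodeLiteral).length ∧
      ∀ l ∈ ls, l.1.val ≤ (ls.flatMap CNF.encodeLiteral).length := by
  induction ls with
  | nil => simp
  | cons l ls ih =>
    simp only [List.flatMap_cons, List.length_cons, List.length_append, List.mem_cons,
      CNF.encodeLiteral, unary, List.length_replicate, List.length_nil]
    refine ⟨by omega, ?_⟩
    rintro l' (rfl | h)
    · omega
    · have := ih.2 l' h
      omega

theorem length_litRows {n : ℕ} (ls : List (Fin n × Bool)) : (R.litRows ls).length = ls.length := by
  induction ls with
  | nil => rfl
  | cons l ls ih => simp [litRows, ih]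

theorem exec_clauseLoop (R : Spec) : ∃ K : ℕ, ∀ (M : ℕ) {n : ℕ} (cs : List (List (Fin n × Bool)))
    (s : Bool) (a c e o), (∀ C ∈ cs, C.length ≤ R.k) →
    a + R.D * (R.clauseRows cs).length ≤ M → (cs.flatMap CNF.encodeClause).length ≤ M → ∃ s',
    Exec R.clauseLoop
      (R.st (cs.flatMap CNF.encodeClause).head? (R.reg s 0 0)
        (cs.flatMap CNF.encodeClause).tail a 0 c 0 e o)
      (K * (M + 1) * (cs.flatMap CNF.encodeClause).length + 1)
      (R.st none (R.reg s' 0 0) [] (a + R.D * (R.clauseRows cs).length) 0 c 0 e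
        (encEdges (R.rowEdges a (R.clauseRows cs)) ++ o)) := by
  obtain ⟨K, hK⟩ := exec_literals R
  obtain ⟨K', hK'⟩ := exec_emitRow R
  refine ⟨K + K' + 7, fun M n cs => ?_⟩
  induction cs with
  | nil =>
    intro s a c e o _ _ _
    exact ⟨s, (Exec.while_done rfl).mono (by simp)⟩
  | cons C cs ih =>
    intro s a c e o hk ha hM
    rw [List.flatMap_cons] at hM ⊢
    set w := cs.flatMap CNF.encodeClause with hw
    have hrows : R.clauseRows (C :: cs) = (none, 0) :: (R.litRows C ++ R.clauseRows cs) := by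
      simp [clauseRows]
    have hrl : (R.clauseRows (C :: cs)).length = C.length + (R.clauseRows cs).length + 1 := by
      rw [hrows, List.length_cons, List.length_append, length_litRows]
    rw [hrl] at ha ⊢
    rw [hrows]
    have hCl := length_le_length_flatMap_encodeLiteral C
    have hlen : (CNF.encodeClause C ++ w).length =
        C.length + 1 + (C.flatMap CNF.encodeLiteral).length + w.length := by
      simp [CNF.encodeClause, unary]
      ring
    rw [hlen] at hM ⊢
    have hhead : (CNF.encodeClause C ++ w) =
        unary C.length ++ (C.flatMap CNF.encodeLiteral ++ w) := by
      simp [CNF.encodeClause]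
    rw [hhead]
    have h₁ := exec_unaryLoop (P := .set fun _ r => (r.1, r.2.1, R.cap (r.2.2 + 1))) (m := 1)
      C.length (fun i => R.st none (R.reg s 0 i) [] a 0 c 0 e o)
      (C.flatMap CNF.encodeLiteral ++ w) fun i _ v => by
        refine (Exec.set _ _).to ?_ le_rfl
        ext1 <;> try rfl
        have : R.cap (R.cap i + 1) = R.cap (i + 1) := Fin.ext (by simp only [cap]; omega)
        simp only [reg, this]
    have h₂ := hK' none (some false) (R.reg s 0 C.length) (C.flatMap CNF.encodeLiteral ++ w) a 0
      c e o
    obtain ⟨x', s', h₃⟩ := hK M C none s w (a + R.D) c e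
      (encEdges (edgesAt a 0 (R.row none)) ++ o) (hk C (by simp)) (by nlinarith)
      (fun l hl => (hCl.2 l hl).trans (by omega))
    have h₄ : Exec .read (R.st x' (R.reg s' 0 0) w (a + R.D + R.D * C.length) 0 c 0 e
        (encEdges (R.rowEdges (a + R.D) (R.litRows C)) ++
          (encEdges (edgesAt a 0 (R.row none)) ++ o))) 1
        (R.st w.head? (R.reg s' 0 0) w.tail (a + R.D + R.D * C.length) 0 c 0 e
        (encEdges (R.rowEdges (a + R.D) (R.litRows C)) ++
          (encEdges (edgesAt a 0 (R.row none)) ++ o))) := Exec.read _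
    obtain ⟨s'', h₅⟩ := ih s' (a + R.D + R.D * C.length) c e
      (encEdges (R.rowEdges (a + R.D) (R.litRows C)) ++
          (encEdges (edgesAt a 0 (R.row none)) ++ o)) (fun C' h => hk C' (by simp [h]))
      (by linarith) (by omega)
    refine ⟨s'', (Exec.while_next ?_ (h₁.seq (h₂.seq (h₃.seq h₄))) h₅).to ?_ ?_⟩
    · cases h : C.length <;> simp [unary, List.replicate_succ]
    · rw [rowEdges, rowEdges_append, length_litRows]
      simp only [encEdges_append, List.append_assoc]
      rw [show a + R.D * (C.length + (R.clauseRows cs).length + 1) =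
        a + R.D + R.D * C.length + R.D * (R.clauseRows cs).length by ring]
    · have : a ≤ M := by nlinarith
      have := Nat.mul_le_mul_left K' this
      have : C.length ≤ M := by omega
      have := hCl.1
      set N := C.length
      set N' := (C.flatMap CNF.encodeLiteral).length
      nlinarith [Nat.zero_le (K * (M + 1)), Nat.zero_le (K' * (M + 1)),
        Nat.zero_le (K * (M + 1) * N'), Nat.zero_le (K' * (M + 1) * N),
        Nat.zero_le (K' * (M + 1) * N'), Nat.zero_le (M * N), Nat.zero_le (M * N')]

theorem exec_squares : ∃ K : ℕ, ∀ (t : ℕ) (x r w o),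
    Exec (loop 2 (.seq (.inc 4) (.seq (emitEdges square) (rep 4 (.inc 0)))))
      (R.st x r w 0 0 t 0 0 o) (K * (t + 1) * (t + 1))
      (R.st none r w (4 * t) 0 0 0 t (encEdges (squares t) ++ o)) := by
  obtain ⟨K, hK⟩ := exec_emitEdges (σ := Reg R.β R.k) square
  refine ⟨4 * K + 10, fun t x r w o => ?_⟩
  have h := exec_loop (P := .seq (.inc 4) (.seq (emitEdges square) (rep 4 (.inc 0)))) (k := 2)
    (m := 1 + (K * (4 * t + 1) + 5)) t
    (fun i => R.st (if i = t then x else none) r w (4 * (t - i)) 0 i 0 (t - i)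
      (encEdges (squares (t - i)) ++ o)) (fun i _ => rfl) fun i hi => by
    obtain ⟨j, hj⟩ : ∃ j, t - (i + 1) = j := ⟨_, rfl⟩
    have ht : t - i = j + 1 := by omega
    rw [hj, ht, if_neg hi.ne]
    have h₁ := Exec.inc 4 (R.st (some true) r w (4 * j) 0 i 0 j (encEdges (squares j) ++ o))
    have h₂ := hK (R.st (some true) r w (4 * j) 0 i 0 (j + 1) (encEdges (squares j) ++ o)) rfl
    have h₃ := exec_rep_inc 0 4 (R.st none r w (4 * j) 0 i 0 (j + 1)
      (encEdges (squares (j + 1)) ++ o))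
    have h₄ := h₂.to (n := K * (4 * t + 1)) (t := R.st none r w (4 * j) 0 i 0 (j + 1)
      (encEdges (squares (j + 1)) ++ o)) (by
        ext1 <;> try rfl
        simp [squares, encEdges_append]) (Nat.mul_le_mul_left K (by simp; omega))
    refine (((h₁.to ?_ le_rfl).seq (h₄.seq h₃)).to ?_ le_rfl).startEq ?_
    all_goals
      ext1 <;> try rfl
      funext a
      fin_cases a <;> rfl
  simp only [Nat.sub_self, Nat.sub_zero, if_true, mul_zero] at h
  exact (h.startEq (by simp [squares, encEdges])).to rfl (by nlinarith)

theorem exec_loop_rep_inc (m : ℕ) (x r w a b c d e o) :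
    Exec (loop 1 (rep m (.inc 2))) (R.st x r w a b c d e o) (b * (m + 3) + 2)
      (R.st none r w a 0 (c + m * b) d e o) := by
  have h := exec_loop (P := rep m (.inc 2)) (k := 1) (m := m + 1) b
    (fun i => R.st (if i = b then x else some true) r w a i (c + m * (b - i)) d e o)
    (fun i _ => rfl) fun i hi => by
      obtain ⟨j, hj⟩ : ∃ j, b - (i + 1) = j := ⟨_, rfl⟩
      have ht : b - i = j + 1 := by omega
      rw [hj, ht, if_neg hi.ne]
      refine ((exec_rep_inc 2 m (R.st (some true) r w a i (c + m * j) d e o)).to ?_ le_rfl).startEq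
        ?_
      all_goals
        ext1 <;> try rfl
        funext a
        fin_cases a <;> try rfl
      simp [mul_add, add_assoc]
  simp only [Nat.sub_self, Nat.sub_zero, if_true, mul_zero, add_zero] at h
  exact h.to rfl le_rfl

theorem exec_loop_inc (x r w a b c d e o) :
    Exec (loop 4 (.inc 2)) (R.st x r w a b c d e o) (e * 3 + 2)
      (R.st none r w a b (c + e) d 0 o) := by
  have h := exec_loop (P := .inc 2) (k := 4) (m := 1) e
    (fun i => R.st (if i = e then x else some true) r w a b (c + (e - i)) d i o)
    (fun i _ => rfl) fun i hi => by
      have ht : c + (e - i) = c + (e - (i + 1)) + 1 := by omega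
      rw [ht, if_neg hi.ne]
      refine ((Exec.inc 2 (R.st (some true) r w a b (c + (e - (i + 1))) d i o)).to ?_ le_rfl).startEq
        ?_
      all_goals
        ext1 <;> try rfl
        funext a
        fin_cases a <;> rfl
  simp only [Nat.sub_self, Nat.sub_zero, if_true, add_zero] at h
  exact h.to rfl (by omega)

theorem exec_loop_emit {k : Fin 5} (s : PState (Reg R.β R.k)) :
    Exec (loop k (.emit true)) s (s.cnt k * 3 + 2) { s with
      cur := none
      cnt := Function.update s.cnt k 0
      out := List.replicate (s.cnt k) true ++ s.out } := by
  have h := exec_loop (P := .emit true) (k := k) (m := 1) (s.cnt k)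
    (fun i => { s with
      cur := if i = s.cnt k then s.cur else some true
      cnt := Function.update s.cnt k i
      out := List.replicate (s.cnt k - i) true ++ s.out })
    (fun i _ => by simp) fun i hi => by
      have ht : s.cnt k - i = s.cnt k - (i + 1) + 1 := by omega
      refine ((Exec.emit true _).to ?_ le_rfl)
      ext1 <;> try rfl
      · simp [hi.ne]
      · simp
      · simp [ht, List.replicate_succ]
  simp only [Nat.sub_self, Nat.sub_zero, if_true, Function.update_eq_self] at h
  exact (h.startEq (by simp)).to rfl (by omega)

theorem edgesAt_fixed (c b : ℕ) (l : List (ℕ × ℕ)) :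
    edgesAt c b (l.map fun e => ((e.1, 0, 0), (e.2, 0, 0))) = l := by
  simp [edgesAt, Term.val, Function.comp_def]

theorem exec_header (R : Spec) : ∃ K : ℕ, ∀ (φ : CNF) (w : List Bool),
    Exec R.header (R.st none (R.reg false 0 0) (unary φ.numVars ++ w) 0 0 0 0 0 [])
      (K * (R.modSize φ + φ.numVars + 1) * (R.modSize φ + φ.numVars + 1))
      (R.st none (R.reg false 0 0) w (4 * R.modSize φ) 0 (R.modSize φ) 0 0
        (encEdges (R.fixed ++ squares (R.modSize φ)))) := by
  obtain ⟨K, hK⟩ := exec_squares (R := R)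
  obtain ⟨K', hK'⟩ := exec_emitEdges (σ := Reg R.β R.k)
    (R.fixed.map fun e => ((e.1, 0, 0), (e.2, 0, 0)))
  refine ⟨K + 4 * K' + R.p + 20, fun φ w => ?_⟩
  set n := φ.numVars
  set b := n / R.β with hb
  set t := R.modSize φ with ht
  have hbn : b ≤ n := Nat.div_le_self _ _
  have htb : t = R.p * b + (R.h + R.p) := by
    rw [ht, modSize]
    ring
  have h₁ := exec_readVar (R := R) none false 0 n w 0 0 0 0 []
  have h₂ : Exec (.set fun _ r => (r.1, R.offset 0, r.2.2))
      (R.st (some false) (R.reg false n 0) w 0 b 0 0 0 []) 1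
      (R.st (some false) (R.reg false 0 0) w 0 b 0 0 0 []) := Exec.set _ _
  have h₃ := exec_loop_rep_inc (R := R) R.p (some false) (R.reg false 0 0) w 0 b 0 0 0 []
  have h₄ := (exec_rep_inc 2 (R.h + R.p) (R.st none (R.reg false 0 0) w 0 0 (0 + R.p * b)
    0 0 [])).to (t := R.st none (R.reg false 0 0) w 0 0 t 0 0 []) (by
      ext1 <;> try rfl
      funext a
      fin_cases a <;> try rfl
      simp [htb]) le_rfl
  have h₅ := hK t none (R.reg false 0 0) w []
  have h₆ := exec_loop_inc (R := R) none (R.reg false 0 0) w (4 * t) 0 0 0 t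
    (encEdges (squares t) ++ [])
  have h₇ := hK' (R.st none (R.reg false 0 0) w (4 * t) 0 (0 + t) 0 0
    (encEdges (squares t) ++ [])) rfl
  refine (h₁.seq (h₂.seq (h₃.seq (h₄.seq (h₅.seq (h₆.seq h₇)))))).to ?_ ?_
  · ext1 <;> try rfl
    · funext a
      fin_cases a <;> try rfl
      simp
    · simp only [edgesAt_fixed, encEdges_append, List.append_nil]
  · change n * 5 + 2 + (1 + (b * (R.p + 3) + 2 + (R.h + R.p + 1 + (K * (t + 1) * (t + 1) +
      (t * 3 + 2 + K' * (4 * t + 0 + 1)))))) ≤ _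
    have e₁ : K * (t + 1) * (t + 1) ≤ K * (t + n + 1) * (t + n + 1) := by gcongr <;> omega
    have e₂ : K' * (4 * t + 0 + 1) ≤ 4 * K' * (t + n + 1) * (t + n + 1) := by
      have : 1 * (4 * t + 0 + 1) ≤ 4 * (t + n + 1) * (t + n + 1) := by nlinarith
      nlinarith [Nat.mul_le_mul_left K' this]
    have e₃ : R.p * b + (R.h + R.p) ≤ R.p * b + (R.h + R.p) := le_rfl
    have e₄ : n * 5 + 8 + b * 3 + 2 * t ≤ 20 * (t + n + 1) * (t + n + 1) := by nlinarith
    nlinarith [Nat.zero_le (R.p * ((t + n + 1) * (t + n + 1)))]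

theorem exec_trailer (R : Spec) : ∃ K : ℕ, ∀ (a t : ℕ) (s : Bool) (o : List Bool),
    Exec R.trailer (R.st none (R.reg s 0 0) [] a 0 t 0 0 o) (K * (a + t + 1))
      (.final (R.reg false 0 0) (unary (a + R.D + R.D) ++ unary t ++
        (encEdges (edgesAt a 0 (R.row none)) ++ o))) := by
  obtain ⟨K, hK⟩ := exec_emitRow R
  refine ⟨K + 7 * R.D + 20, fun a t s o => ?_⟩
  set o₁ := encEdges (edgesAt a 0 (R.row none)) ++ o
  have h₁ := hK none none (R.reg s 0 0) [] a 0 t 0 o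
  have h₂ := (exec_rep_inc 0 R.D (R.st none (R.reg s 0 0) [] (a + R.D) 0 t 0 0 o₁)).to
    (t := R.st none (R.reg s 0 0) [] (a + R.D + R.D) 0 t 0 0 o₁) (by
      ext1 <;> try rfl
      funext a
      fin_cases a <;> rfl) le_rfl
  have h₃ := Exec.emit false (R.st none (R.reg s 0 0) [] (a + R.D + R.D) 0 t 0 0 o₁)
  have h₄ := (exec_loop_emit (k := 2) (R.st none (R.reg s 0 0) [] (a + R.D + R.D) 0 t 0 0
    (false :: o₁))).to (t := R.st none (R.reg s 0 0) [] (a + R.D + R.D) 0 0 0 0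
    (unary t ++ o₁)) (by
      ext1 <;> try rfl
      · funext a
        fin_cases a <;> rfl
      · simp [unary]) le_rfl
  have h₅ := Exec.emit false (R.st none (R.reg s 0 0) [] (a + R.D + R.D) 0 0 0 0 (unary t ++ o₁))
  have h₆ := (exec_loop_emit (k := 0) (R.st none (R.reg s 0 0) [] (a + R.D + R.D) 0 0 0 0
    (false :: (unary t ++ o₁)))).to (t := R.st none (R.reg s 0 0) [] 0 0 0 0 0
    (unary (a + R.D + R.D) ++ unary t ++ o₁)) (by
      ext1 <;> try rfl
      · funext a
        fin_cases a <;> rfl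
      · simp [unary]) le_rfl
  have h₇ := Exec.set (fun _ _ => R.reg false 0 0) (R.st none (R.reg s 0 0) [] 0 0 0 0 0
    (unary (a + R.D + R.D) ++ unary t ++ o₁))
  refine (h₁.seq (h₂.seq (h₃.seq (h₄.seq (h₅.seq (h₆.seq h₇)))))).to ?_ ?_
  · ext1 <;> try rfl
    funext a
    fin_cases a <;> rfl
  · change K * (a + 0 + 1) + (R.D + 1 + (1 + (t * 3 + 2 + (1 + ((a + R.D + R.D) * 3 + 2 + 1))))) ≤ _
    nlinarith [Nat.zero_le (K * t), Nat.zero_le (R.D * (a + t))]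

theorem length_clauseRows_le {n : ℕ} (cs : List (List (Fin n × Bool))) :
    (R.clauseRows cs).length ≤ (cs.flatMap CNF.encodeClause).length := by
  induction cs with
  | nil => simp [clauseRows]
  | cons C cs ih =>
    have := (length_le_length_flatMap_encodeLiteral C).1
    simp only [clauseRows, List.flatMap_cons, List.length_append, List.length_cons, length_litRows,
      CNF.encodeClause, unary, List.length_replicate] at ih ⊢
    simp only [List.length_nil]
    omega

/-- A step writes at most one symbol; this bounds the size of the constructed instance by the
running time of the reduction. -/
theorem _root_.FineGrained.Exec.length_out_le {σ : Type} {P : Prog σ} {s s' : PState σ} {n : ℕ}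
    (h : Exec P s n s') : s'.out.length ≤ s.out.length + n := by
  induction h with
  | emit => simp
  | seq => omega
  | switch => omega
  | while_next => omega
  | mono => omega
  | _ => exact Nat.le_add_right _ _

/-- The reduction program is correct and runs in quadratic time. -/
theorem exec_prog (R : Spec) : ∃ K : ℕ, ∀ φ : CNF, φ.WidthLE R.k →
    Exec R.prog (.start (R.reg false 0 0) φ.encode)
      (K * ((φ.encode.length + 1) * (φ.encode.length + 1)))
      (.final (R.reg false 0 0) (R.output φ)) := by
  obtain ⟨K₁, hK₁⟩ := exec_header R
  obtain ⟨K₂, hK₂⟩ := exec_clauseLoop R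
  obtain ⟨K₃, hK₃⟩ := exec_trailer R
  set A := R.h + 2 * R.p with hA
  refine ⟨K₁ * (A + 2) * (A + 2) + K₂ * (4 * A + R.D + 2) + K₃ * (5 * A + R.D + 2) + 2,
    fun φ hφ => ?_⟩
  set W := φ.clauses.flatMap CNF.encodeClause with hW
  set N := φ.encode.length + 1 with hN
  set t := R.modSize φ with ht
  set n := φ.numVars with hn
  have hlen : N = n + 1 + W.length + 1 := by
    simp [hN, CNF.encode, unary, ← hn, ← hW]
    omega
  have hrows : (R.clauseRows φ.clauses).length ≤ W.length := length_clauseRows_le _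
  have htN : t ≤ A * N := by
    have h₁ : n / R.β ≤ n := Nat.div_le_self _ _
    have h₂ : n / R.β + 1 ≤ N := by omega
    have h₃ := Nat.mul_le_mul_left R.p h₂
    rw [ht, modSize, hA]
    nlinarith [Nat.zero_le (R.h * n), Nat.zero_le (R.h * W.length)]
  have hDN : R.D * (R.clauseRows φ.clauses).length ≤ R.D * N := Nat.mul_le_mul_left _ (by omega)
  set M := (4 * A + R.D + 1) * N with hM
  have h₁ := hK₁ φ W
  set o := encEdges (R.fixed ++ squares t)
  have h₂ : Exec .read (R.st none (R.reg false 0 0) W (4 * t) 0 t 0 0 o) 1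
    (R.st W.head? (R.reg false 0 0) W.tail (4 * t) 0 t 0 0 o) := Exec.read _
  have hMa : 4 * t + R.D * (R.clauseRows φ.clauses).length ≤ M := by
    rw [hM]
    linarith
  obtain ⟨s, h₃⟩ := hK₂ M φ.clauses false (4 * t) t 0 o hφ hMa (by
    have : 1 * N ≤ M := Nat.mul_le_mul_right _ (by omega)
    change W.length ≤ M
    omega)
  have h₄ := hK₃ (4 * t + R.D * (R.clauseRows φ.clauses).length) t s
    (encEdges (R.rowEdges (4 * t) (R.clauseRows φ.clauses)) ++ o)
  have hst : PState.start (R.reg false 0 0) φ.encode =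
      R.st none (R.reg false 0 0) (unary φ.numVars ++ W) 0 0 0 0 0 [] := by
    ext1 <;> try rfl
    funext a
    fin_cases a <;> rfl
  refine ((h₁.seq (h₂.seq (h₃.seq h₄))).to ?_ ?_).startEq hst
  · congr 1
    simp only [output, edgeList, rows, order, rowEdges_append, encEdges_append, List.length_append,
      rowEdges, List.append_assoc, List.length_singleton, o]
    rw [show 4 * t + R.D * (R.clauseRows φ.clauses).length + R.D + R.D =
      4 * R.modSize φ + R.D * ((R.clauseRows φ.clauses).length + 1 + 1) by rw [ht]; ring]
    simp [encEdges, ← ht]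
  · have hN1 : 1 ≤ N := by omega
    have e₁ : K₁ * (t + n + 1) * (t + n + 1) ≤ K₁ * ((A + 2) * N) * ((A + 2) * N) := by
      have : t + n + 1 ≤ (A + 2) * N := by linarith
      gcongr
    have e₂ : K₂ * (M + 1) * W.length ≤ K₂ * ((4 * A + R.D + 2) * N) * N := by
      have : M + 1 ≤ (4 * A + R.D + 2) * N := by linarith
      gcongr
      omega
    have e₃ : K₃ * (4 * t + R.D * (R.clauseRows φ.clauses).length + t + 1) ≤
        K₃ * ((5 * A + R.D + 2) * N * N) := by
      have h5 : 4 * t + R.D * (R.clauseRows φ.clauses).length + t + 1 ≤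
        (5 * A + R.D + 2) * N * 1 := by linarith
      exact Nat.mul_le_mul_left _ (h5.trans (Nat.mul_le_mul_left _ hN1))
    have e₄ : 1 ≤ N * N := by nlinarith
    calc _ ≤ K₁ * ((A + 2) * N) * ((A + 2) * N) + (1 + (K₂ * ((4 * A + R.D + 2) * N) * N + 1 +
          K₃ * ((5 * A + R.D + 2) * N * N))) := by gcongr
      _ ≤ _ := by nlinarith

end Spec

end FineGrained

namespace FineGrained

/-! ### Caterpillar forests and the distance to them -/

section Caterpillar

variable {V : Type*} {G : SimpleGraph V}

/-- A discrete intermediate value theorem: `f` changes by one along each edge, so a walk that passes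
from at most `n` to above `n` uses an edge from level `n` to level `n + 1`. -/
theorem exists_crossing_edge {f : V → ℕ} (h : ∀ u v, G.Adj u v → f u = f v + 1 ∨ f v = f u + 1)
    (n : ℕ) {u v : V} (p : G.Walk u v) (hu : f u ≤ n) (hv : n < f v) :
    ∃ a b, s(a, b) ∈ p.edges ∧ f a = n ∧ f b = n + 1 := by
  induction p with
  | nil => omega
  | @cons u w v huw p ih =>
    by_cases hw : f w ≤ n
    · obtain ⟨a, b, hab, h⟩ := ih hw hv
      exact ⟨a, b, by simp [hab], h⟩
    · exact ⟨u, w, by simp, by have := h u w huw; omega, by have := h u w huw; omega⟩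

/-- Such a graph is a union of paths. Injectivity of `f` makes the crossing edge between two levels
unique, so every edge is a bridge. In a component, a path from the minimum to the maximum of `f`
crosses every intermediate level and thus visits every vertex. -/
theorem isCaterpillarForest_of_consecutive [Finite V] {f : V → ℕ} (hf : Function.Injective f)
    (h : ∀ u v, G.Adj u v → f u = f v + 1 ∨ f v = f u + 1) : IsCaterpillarForest G := by
  have hbr : ∀ u v, G.Adj u v → f v = f u + 1 → G.IsBridge s(u, v) := by
    intro u v _ huv
    rw [SimpleGraph.isBridge_iff_forall_walk_mem_edges]
    intro p
    obtain ⟨a, b, hab, ha, hb⟩ := exists_crossing_edge h (f u) p le_rfl (by omega)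
    rwa [hf ha, hf (hb.trans huv.symm)] at hab
  have hac : G.IsAcyclic := by
    rw [SimpleGraph.isAcyclic_iff_forall_adj_isBridge]
    intro u v huv
    rcases h u v huv with h' | h'
    · rw [Sym2.eq_swap]
      exact hbr v u huv.symm h'
    · exact hbr u v huv h'
  refine ⟨hac, fun c => ⟨hac.isTree_connectedComponent c, ?_⟩⟩
  classical
  have hne : Nonempty c := c.connected_toSimpleGraph.nonempty
  obtain ⟨u, hu⟩ := Finite.exists_min fun x : c => f x
  obtain ⟨v, hv⟩ := Finite.exists_max fun x : c => f x
  obtain ⟨p⟩ := c.connected_toSimpleGraph.preconnected u v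
  refine ⟨u, v, p.toPath, p.toPath.2, fun w hw => absurd ?_ hw⟩
  rcases (hv w).eq_or_lt with h' | h'
  · rw [Subtype.ext (hf h')]
    exact SimpleGraph.Walk.end_mem_support _
  · obtain ⟨a, b, hab, ha, -⟩ := exists_crossing_edge (G := c.toSimpleGraph) (f := fun x => f x)
      (fun x y hxy => h x y hxy) (f w) (p.toPath : c.toSimpleGraph.Walk u v) (hu w) h'
    rw [← Subtype.ext (hf ha)]
    exact SimpleGraph.Walk.fst_mem_support_of_mem_edges _ hab

/-- The two ways around the square are different paths from `a` to `c`. -/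
theorem not_isAcyclic_of_square {a b c d : V} (hab : G.Adj a b) (hbc : G.Adj b c)
    (hcd : G.Adj c d) (hda : G.Adj d a) (hac : a ≠ c) (hbd : b ≠ d) : ¬ G.IsAcyclic := by
  intro h
  let p : G.Walk a c := .cons hab (.cons hbc .nil)
  let q : G.Walk a c := .cons hda.symm (.cons hcd.symm .nil)
  have hp : p.IsPath := by simp [p, hab.ne, hbc.ne, hac]
  have hq : q.IsPath := by simp [q, hda.ne.symm, hcd.ne.symm, hac]
  have := congrArg (fun r : G.Path a c => r.1.support) ((h.subsingleton_path a c).elim ⟨p, hp⟩ ⟨q, hq⟩)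
  simp [p, q] at this
  exact hbd this

/-- If deleting one vertex from each of a family of disjoint 4-cycles leaves a graph whose edges
join consecutive numbers, then the size of the family is the distance to a caterpillar forest. -/
theorem caterpillarDist_eq_card [Fintype V] {ι : Type*} [Fintype ι] (sq : ι → Fin 4 → V)
    (hinj : ∀ i j i' j', sq i j = sq i' j' → i = i' ∧ j = j')
    (hsq : ∀ i j, G.Adj (sq i j) (sq i (j + 1))) (f : V → ℕ)
    (hf : ∀ u v, (∀ i, u ≠ sq i 0) → (∀ i, v ≠ sq i 0) → f u = f v → u = v)
    (hadj : ∀ u v, (∀ i, u ≠ sq i 0) → (∀ i, v ≠ sq i 0) → G.Adj u v →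
      f u = f v + 1 ∨ f v = f u + 1) :
    caterpillarDist G = Fintype.card ι := by
  classical
  have hmem : ∃ S : Finset V, S.card = Fintype.card ι ∧
      IsCaterpillarForest (G.induce ((S : Set V)ᶜ)) := by
    refine ⟨Finset.univ.image fun i => sq i 0, ?_, ?_⟩
    · rw [Finset.card_image_of_injective _ fun i j h => (hinj _ _ _ _ h).1, Finset.card_univ]
    · refine isCaterpillarForest_of_consecutive (f := fun x => f x) ?_ ?_
      · rintro ⟨u, hu⟩ ⟨v, hv⟩ h
        simp only [Finset.coe_image, Finset.coe_univ, Set.image_univ, Set.mem_compl_iff,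
          Set.mem_range, not_exists] at hu hv
        exact Subtype.ext (hf u v (fun i h => hu i h.symm) (fun i h => hv i h.symm) h)
      · rintro ⟨u, hu⟩ ⟨v, hv⟩ h
        simp only [Finset.coe_image, Finset.coe_univ, Set.image_univ, Set.mem_compl_iff,
          Set.mem_range, not_exists] at hu hv
        exact hadj u v (fun i h => hu i h.symm) (fun i h => hv i h.symm) h
  refine le_antisymm (Nat.sInf_le hmem) (le_csInf ⟨_, hmem⟩ ?_)
  rintro t ⟨S, rfl, hS⟩
  -- Lower bound: a deletion set must meet every 4-cycle, and the 4-cycles are disjoint.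
  have hcut : ∀ i, ∃ j, sq i j ∈ S := by
    intro i
    by_contra! hi
    have hne : ∀ {j j' : Fin 4}, j ≠ j' → sq i j ≠ sq i j' := fun h e => h (hinj _ _ _ _ e).2
    exact not_isAcyclic_of_square (G := G.induce ((S : Set V)ᶜ))
      (a := ⟨sq i 0, by simpa using hi 0⟩) (b := ⟨sq i 1, by simpa using hi 1⟩)
      (c := ⟨sq i 2, by simpa using hi 2⟩) (d := ⟨sq i 3, by simpa using hi 3⟩)
      (hsq i 0) (hsq i 1) (hsq i 2) (hsq i 3)
      (fun e => hne (by decide) (congrArg Subtype.val e))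
      (fun e => hne (by decide) (congrArg Subtype.val e)) hS.1
  choose j hj using hcut
  rw [← Finset.card_univ]
  exact Finset.card_le_card_of_injOn (fun i => sq i (j i)) (fun i _ => hj i)
    fun i _ i' _ h => (hinj _ _ _ _ h).1

end Caterpillar

/-! ### Triangle-free graphs that are uniquely colorable -/

/-- The shift graph: pairs `i < j`, where `(i, j)` is joined to `(j, k)`. -/
def shiftGraph (N : ℕ) : SimpleGraph {x : Fin N × Fin N // x.1 < x.2} where
  Adj x y := x.1.2 = y.1.1 ∨ y.1.2 = x.1.1
  symm := ⟨fun _ _ h => h.symm⟩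
  loopless := ⟨fun x h => by
    have := x.2
    rcases h with h | h <;> exact absurd h (ne_of_gt this)⟩

theorem cliqueFree_three_iff {V : Type*} {G : SimpleGraph V} :
    G.CliqueFree 3 ↔ ∀ a b c, G.Adj a b → G.Adj a c → G.Adj b c → False := by
  classical
  constructor
  · intro h a b c hab hac hbc
    exact h {a, b, c} (SimpleGraph.is3Clique_triple_iff.2 ⟨hab, hac, hbc⟩)
  · intro h s hs
    obtain ⟨a, b, c, hab, hac, hbc, -⟩ := SimpleGraph.is3Clique_iff.1 hs
    exact h a b c hab hac hbc

theorem shiftGraph_cliqueFree (N : ℕ) : (shiftGraph N).CliqueFree 3 := by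
  rw [cliqueFree_three_iff]
  intro x y z h₁ h₂ h₃
  have hx := x.2
  have hy := y.2
  have hz := z.2
  simp only [shiftGraph] at h₁ h₂ h₃
  omega

theorem shiftGraph_not_colorable (q : ℕ) : ¬ (shiftGraph (2 ^ q + 1)).Colorable q := by
  rintro ⟨c⟩
  -- The set `A i` collects the colors of the pairs that start with `i`. For `i < j` the color of
  -- `(i, j)` lies in `A i` but not in `A j`, so there would be `2 ^ q + 1` different sets of
  -- colors.
  let A : Fin (2 ^ q + 1) → Set (Fin q) := fun i => {a | ∃ x, x.1.1 = i ∧ c x = a}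
  have hA : Function.Injective A := by
    have key : ∀ i j, i < j → A i ≠ A j := by
      intro i j hij h
      have h₁ : c ⟨(i, j), hij⟩ ∈ A i := ⟨_, rfl, rfl⟩
      rw [h] at h₁
      obtain ⟨x, hx, hc⟩ := h₁
      exact c.valid (v := x) (w := ⟨(i, j), hij⟩) (Or.inr hx.symm) hc
    intro i j h
    rcases lt_trichotomy i j with h' | h' | h'
    · exact absurd h (key i j h')
    · exact h'
    · exact absurd h.symm (key j i h')
  have := Fintype.card_le_of_injective A hA
  simp at this

/-- The product of a graph with a complete graph. -/
def tensorComplete {V : Type*} (H : SimpleGraph V) (q : ℕ) : SimpleGraph (V × Fin q) where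
  Adj x y := H.Adj x.1 y.1 ∧ x.2 ≠ y.2
  symm := ⟨fun _ _ h => ⟨h.1.symm, h.2.symm⟩⟩
  loopless := ⟨fun _ h => h.2 rfl⟩

/-- The product of a connected graph that is not `q`-colorable with the complete graph on `q`
vertices is uniquely `q`-colorable. -/
theorem tensorComplete_coloring {V : Type*} {H : SimpleGraph V} {q : ℕ} (hc : H.Connected)
    (hq : ¬ H.Colorable q) (c : (tensorComplete H q).Coloring (Fin q)) :
    ∃ π : Equiv.Perm (Fin q), ∀ v a, c (v, a) = π a := by
  -- Some fiber gets pairwise different colors. Otherwise each fiber repeats a color, and giving `v`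
  -- the color repeated over `v` would properly color `H`: of the two occurrences over `v`, one is
  -- adjacent to a given occurrence over a neighbor.
  have h₁ : ∃ v, Function.Injective fun a => c (v, a) := by
    by_contra! h
    simp only [Function.Injective] at h
    push Not at h
    choose a b hab hne using h
    refine hq ⟨SimpleGraph.Coloring.mk (fun v => c (v, a v)) fun {v w} hvw e => ?_⟩
    by_cases h' : a v = a w
    · refine c.valid (v := (v, b v)) (w := (w, a w)) ⟨hvw, ?_⟩ ((hab v).symm.trans e)
      rw [← h']
      exact (hne v).symm
    · exact c.valid (v := (v, a v)) (w := (w, a w)) ⟨hvw, h'⟩ e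
  obtain ⟨v, hv⟩ := h₁
  have hbij := Finite.injective_iff_bijective.1 hv
  refine ⟨Equiv.ofBijective _ hbij, fun w a => ?_⟩
  obtain ⟨p⟩ := hc.preconnected v w
  change c (w, a) = c (v, a)
  -- A fiber with all `q` colors forces the same order on neighboring fibers: `(z, a)` is adjacent
  -- to all `(x, b)` with `b ≠ a`, which leaves only the color of `(x, a)`.
  have key : ∀ {x y : V} (_ : H.Walk x y), (Function.Injective fun a => c (x, a)) →
      ∀ a, c (y, a) = c (x, a) := by
    intro x y p
    induction p with
    | nil => exact fun _ _ => rfl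
    | @cons x z y hxz p ih =>
      intro hx
      have hz : ∀ a, c (z, a) = c (x, a) := by
        intro a
        obtain ⟨b, hb⟩ := (Finite.injective_iff_surjective.1 hx) (c (z, a))
        by_cases hba : b = a
        · rw [← hb, hba]
        · exact absurd hb (c.valid (v := (x, b)) (w := (z, a)) ⟨hxz, hba⟩)
      intro a
      rw [ih (by simpa only [hz] using hx) a, hz a]
  exact key p hv a

/-- There is a triangle-free graph with two disjoint lists of `q` vertices that get the same
`q` different colors, in the same order, in every `q`-coloring. -/
theorem exists_palette {q : ℕ} (hq : 1 ≤ q) : ∃ (h : ℕ) (H : SimpleGraph (Fin h))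
    (τ : Bool → Fin q → Fin h), H.CliqueFree 3 ∧ (∀ b a a', ¬ H.Adj (τ b a) (τ b a')) ∧
    (∀ a a', τ false a ≠ τ true a') ∧
    (∃ c : H.Coloring (Fin q), ∀ b a, c (τ b a) = a) ∧
    ∀ c : H.Coloring (Fin q), ∃ π : Equiv.Perm (Fin q), ∀ b a, c (τ b a) = π a := by
  obtain ⟨C, hC⟩ := not_forall.1
    (mt SimpleGraph.colorable_iff_forall_connectedComponent.2 (shiftGraph_not_colorable q))
  classical
  -- The fibers over two different vertices of the component provide the two lists; a fiber has no
  -- edges inside.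
  obtain ⟨u, v, huv⟩ : ∃ u v : C, u ≠ v := by
    by_contra! h
    exact hC ⟨SimpleGraph.Coloring.mk (fun _ => ⟨0, hq⟩) fun {a b} hab =>
      absurd (h a b) hab.ne⟩
  let X := tensorComplete C.toSimpleGraph q
  have : Fintype C := Fintype.ofFinite C
  let e := Fintype.equivFin (C × Fin q)
  let φ : X ≃g X.map e.toEmbedding := SimpleGraph.Iso.map e X
  refine ⟨Fintype.card (C × Fin q), X.map e.toEmbedding, fun b a => e (bif b then u else v, a),
    ?_, ?_, ?_, ?_, ?_⟩
  · rw [cliqueFree_three_iff]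
    have hfree := cliqueFree_three_iff.1 (shiftGraph_cliqueFree (2 ^ q + 1))
    intro a b c hab hac hbc
    rw [← φ.symm.map_adj_iff] at hab hac hbc
    exact hfree _ _ _ hab.1 hac.1 hbc.1
  · intro b a a' h
    have : X.Adj (bif b then u else v, a) (bif b then u else v, a') := φ.map_adj_iff.1 h
    exact this.1.ne rfl
  · intro a a' h
    simpa using huv.symm (congrArg Prod.fst (e.injective h))
  · refine ⟨SimpleGraph.Coloring.mk (fun x => (e.symm x).2) fun {x y} hxy => ?_, fun b a => ?_⟩
    · exact (φ.symm.map_adj_iff.2 hxy).2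
    · change (e.symm (e _)).2 = a
      simp
  · intro c
    obtain ⟨π, hπ⟩ := tensorComplete_coloring C.connected_toSimpleGraph hC (c.comp φ.toHom)
    exact ⟨π, fun b a => hπ _ _⟩

end FineGrained

namespace FineGrained

/-! ### Graphs consisting of a modulator and paths -/

section Frame

variable {S Q : Type} (H : SimpleGraph S) (pos : Q → ℕ) (link : Q → Q → Prop)
  (hl : ∀ a b, link a b → pos b = pos a + 1) (att : Q → S → Prop)

/-- The graph with a modulator `S`, on which it is `H`, each vertex of which lies on a private
4-cycle, and with further vertices `Q`, on which the edges are the links. -/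
def frame : SimpleGraph ((S × Fin 4) ⊕ Q) where
  Adj
    | .inl x, .inl y => (x.1 = y.1 ∧ x.2.val % 2 ≠ y.2.val % 2) ∨ (x.2 = 0 ∧ y.2 = 0 ∧ H.Adj x.1 y.1)
    | .inl x, .inr a => x.2 = 0 ∧ att a x.1
    | .inr a, .inl x => x.2 = 0 ∧ att a x.1
    | .inr a, .inr b => link a b ∨ link b a
  symm := ⟨by
    rintro (x | a) (y | b) h
    · rcases h with h | h
      · exact .inl ⟨h.1.symm, h.2.symm⟩
      · exact .inr ⟨h.2.1, h.1, h.2.2.symm⟩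
    · exact h
    · exact h
    · exact h.symm⟩
  loopless := ⟨by
    rintro (x | a) h
    · rcases h with h | h
      · exact h.2 rfl
      · exact h.2.2.ne rfl
    · have := hl a a (or_self_iff.1 h)
      omega⟩

variable {H pos link hl att}

/-- The 4-cycles are bipartite and meet the copy of `H` in one vertex each. A triangle with one path
vertex needs adjacent attachments, one with two path vertices needs a common attachment, and three
path vertices are excluded because `pos` changes parity along links. -/
theorem frame_cliqueFree (hH : H.CliqueFree 3)
    (hatt : ∀ a s s', att a s → att a s' → ¬ H.Adj s s')
    (hlink : ∀ a b s, link a b → att a s → ¬ att b s) :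
    (frame H pos link hl att).CliqueFree 3 := by
  rw [cliqueFree_three_iff] at hH ⊢
  have hl' : ∀ a b, link a b ∨ link b a → pos b = pos a + 1 ∨ pos a = pos b + 1 :=
    fun a b h => h.imp (hl a b) (hl b a)
  rintro (⟨s, i⟩ | a) (⟨t, j⟩ | b) (⟨u, k⟩ | c) h₁ h₂ h₃ <;> simp only [frame] at h₁ h₂ h₃
  · by_cases h : s = t ∨ s = u ∨ t = u
    · have e : ∀ {x y : S}, H.Adj x y → x ≠ y := fun h => h.ne
      rcases h₁ with h₁ | ⟨rfl, rfl, h₁⟩ <;> rcases h₂ with h₂ | ⟨h₂', rfl, h₂⟩ <;>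
        rcases h₃ with h₃ | ⟨h₃', h₃'', h₃⟩ <;> grind
    · push Not at h
      simp only [h.1, h.2.1, h.2.2, false_and, false_or] at h₁ h₂ h₃
      exact hH _ _ _ h₁.2.2 h₂.2.2 h₃.2.2
  · rcases h₁ with h₁ | h₁
    · simp [h₂.1, h₃.1] at h₁
    · exact hatt _ _ _ h₂.2 h₃.2 h₁.2.2
  · rcases h₂ with h₂ | h₂
    · simp [h₁.1, h₃.1] at h₂
    · exact hatt _ _ _ h₁.2 h₃.2 h₂.2.2
  · rcases h₃ with h₃ | h₃
    · exact hlink _ _ _ h₃ h₁.2 h₂.2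
    · exact hlink _ _ _ h₃ h₂.2 h₁.2
  · rcases h₃ with h₃ | h₃
    · simp [h₁.1, h₂.1] at h₃
    · exact hatt _ _ _ h₁.2 h₂.2 h₃.2.2
  · rcases h₂ with h₂ | h₂
    · exact hlink _ _ _ h₂ h₁.2 h₃.2
    · exact hlink _ _ _ h₂ h₃.2 h₁.2
  · rcases h₁ with h₁ | h₁
    · exact hlink _ _ _ h₁ h₂.2 h₃.2
    · exact hlink _ _ _ h₁ h₃.2 h₂.2
  · have := hl' _ _ h₁
    have := hl' _ _ h₂
    have := hl' _ _ h₃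
    omega

/-- The 4-cycles impose nothing: opposite corners repeat the color of the modulator vertex, and the
other two corners take any different color. -/
theorem frame_colorable {q : ℕ} (hq : 2 ≤ q) :
    (frame H pos link hl att).Colorable q ↔ ∃ (cS : H.Coloring (Fin q)) (cQ : Q → Fin q),
      (∀ a b, link a b → cQ a ≠ cQ b) ∧ ∀ a s, att a s → cQ a ≠ cS s := by
  constructor
  · rintro ⟨c⟩
    refine ⟨SimpleGraph.Coloring.mk (fun s => c (.inl (s, 0))) fun {s t} h =>
      c.valid (v := .inl (s, 0)) (w := .inl (t, 0)) (.inr ⟨rfl, rfl, h⟩), fun a => c (.inr a),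
      fun a b h => c.valid (v := .inr a) (w := .inr b) (.inl h),
      fun a s h => c.valid (v := .inr a) (w := .inl (s, 0)) ⟨rfl, h⟩⟩
  · rintro ⟨cS, cQ, h₁, h₂⟩
    have : Fact (1 < q) := ⟨hq⟩
    have : NeZero q := ⟨by omega⟩
    have hne : ∀ x : Fin q, ∃ y : Fin q, y ≠ x := fun x =>
      haveI : Nontrivial (Fin q) := Fin.nontrivial_iff_two_le.2 hq
      exists_ne x
    choose g hg using hne
    refine ⟨SimpleGraph.Coloring.mk (Sum.elim
      (fun x => if x.2.val % 2 = 0 then cS x.1 else g (cS x.1)) cQ) ?_⟩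
    rintro (⟨s, i⟩ | a) (⟨t, j⟩ | b) h <;> simp only [frame] at h <;>
      simp only [Sum.elim_inl, Sum.elim_inr]
    · rcases h with ⟨rfl, h⟩ | ⟨rfl, rfl, h⟩
      · by_cases hi : i.val % 2 = 0
        · rw [if_pos hi, if_neg (by omega)]
          exact (hg _).symm
        · rw [if_neg hi, if_pos (by omega)]
          exact hg _
      · simpa using cS.valid h
    · obtain ⟨rfl, h⟩ := h
      simpa using (h₂ _ _ h).symm
    · obtain ⟨rfl, h⟩ := h
      simpa using h₂ _ _ h
    · rcases h with h | h
      · exact h₁ _ _ h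
      · exact (h₁ _ _ h).symm

theorem caterpillarDist_frame [Fintype S] {V : Type} [Fintype V] {G : SimpleGraph V}
    (φ : frame H pos link hl att ≃g G) (hpos : Function.Injective pos) :
    caterpillarDist G = Fintype.card S := by
  let e := Fintype.equivFin S
  -- Without corner `0`, a 4-cycle is the path through corners `1`, `2`, `3`, numbered
  -- consecutively.
  let f : (S × Fin 4) ⊕ Q → ℕ :=
    Sum.elim (fun x => 4 * e x.1 + x.2) fun a => 4 * Fintype.card S + 1 + pos a
  have hf : Function.Injective f := by
    rintro (⟨s, i⟩ | a) (⟨t, j⟩ | b) h <;> simp only [f, Sum.elim_inl, Sum.elim_inr] at h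
    · have h₁ : e s = e t := Fin.ext (by omega)
      have h₂ : i = j := Fin.ext (by omega)
      rw [e.injective h₁, h₂]
    · have := (e s).2
      omega
    · have := (e t).2
      omega
    · rw [hpos (by omega : pos a = pos b)]
  refine caterpillarDist_eq_card (fun s j => φ (.inl (s, j))) ?_ ?_ (fun v => f (φ.symm v)) ?_ ?_
  · intro i j i' j' h
    have := φ.injective h
    simpa using this
  · intro s j
    refine φ.map_adj_iff.2 (.inl ⟨rfl, ?_⟩)
    change j.val % 2 ≠ (j + 1).val % 2
    revert j
    decide
  · intro u v _ _ h
    exact φ.symm.injective (hf h)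
  · intro u v hu hv h
    rw [← φ.symm.map_adj_iff] at h
    have hu' : ∀ s, φ.symm u ≠ .inl (s, 0) := fun s h => hu s (by rw [← h]; simp)
    have hv' : ∀ s, φ.symm v ≠ .inl (s, 0) := fun s h => hv s (by rw [← h]; simp)
    generalize φ.symm u = x at *
    generalize φ.symm v = y at *
    rcases x with ⟨s, i⟩ | a <;> rcases y with ⟨t, j⟩ | b <;> simp only [frame] at h <;>
      simp only [f, Sum.elim_inl, Sum.elim_inr]
    · rcases h with ⟨rfl, h⟩ | ⟨rfl, rfl, h⟩
      · have hi : i.val ≠ 0 := fun h => hu' s (by rw [show i = 0 from Fin.ext h])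
        have hj : j.val ≠ 0 := fun h => hv' s (by rw [show j = 0 from Fin.ext h])
        omega
      · exact absurd rfl (hu' s)
    · exact absurd (by rw [h.1]) (hu' s)
    · exact absurd (by rw [h.1]) (hv' t)
    · rcases h with h | h
      · have := hl _ _ h
        omega
      · have := hl _ _ h
        omega

end Frame

end FineGrained

/-! ### The graph of the reduction -/

namespace FineGrained

/-- The choices on which the reduction depends: a palette for `q` colors, and a surjective decoding
of the colorings of `p` vertices to the assignments of `β` variables. -/
structure Design where
  /-- number of colors -/
  q : ℕ
  /-- number of vertices for a block of variables -/
  p : ℕ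
  /-- size of a block of variables -/
  β : ℕ
  /-- width of the formulas -/
  k : ℕ
  /-- number of vertices of the palette -/
  h : ℕ
  /-- the palette -/
  H : SimpleGraph (Fin h)
  /-- the two lists of colors of the palette -/
  τ : Bool → Fin q → Fin h
  /-- the decoding of colorings -/
  dec : (Fin p → Fin q) → Fin β → Bool
  three_le_q : 3 ≤ q
  one_le_p : 1 ≤ p
  β_pos : 0 < β
  dec_surjective : Function.Surjective dec
  H_cliqueFree : H.CliqueFree 3
  τ_not_adj : ∀ b a a', ¬ H.Adj (τ b a) (τ b a')
  τ_ne : ∀ a a', τ false a ≠ τ true a'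
  exists_coloring : ∃ c : H.Coloring (Fin q), ∀ b a, c (τ b a) = a
  coloring_unique : ∀ c : H.Coloring (Fin q), ∃ π : Equiv.Perm (Fin q), ∀ b a, c (τ b a) = π a

namespace Design

variable (X : Design)

/-- For each literal of a clause, a coloring of the block of its variable. -/
abbrev Lane : Type := Fin (X.k + 1) → Fin X.p → Fin X.q

/-- The vertices of a row: each lane has `p` units of six vertices. -/
abbrev Cell : Type := X.Lane × Fin X.p × Fin 6

/-- The number of a vertex within its row. -/
noncomputable def cellEquiv : X.Cell ≃ Fin (Fintype.card X.Lane * (X.p * 6)) :=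
  ((Fintype.equivFin X.Lane).prodCongr finProdFinEquiv).trans finProdFinEquiv

theorem cellEquiv_val (x : X.Cell) : (X.cellEquiv x).val =
    x.2.2 + 6 * x.2.1 + X.p * 6 * Fintype.equivFin X.Lane x.1 := rfl

/-- The colors of the vertices of a separator row. -/
def sepColor (i : ℕ) (j : Fin 6) : ℕ :=
  -- The row must begin with `0`, to reject an incoming signal, and end with `0`, to send a new one.
  -- Six alternating colors cannot do both, so the first unit uses the color `2` once.
  if i = 0 then ![0, 1, 0, 1, 2, 0] j else ![1, 0, 1, 0, 1, 0] j

/-- The color that signals before the test for the color `c`. -/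
def aliveColor (c : ℕ) : ℕ := if c = 0 then 1 else 0

/-- The color that does not signal before the test for the color `c`. -/
def deadColor (c : ℕ) : ℕ := if c ≤ 1 then 2 else 1

/-- The colors allowed in a unit that tests for the color `c`. -/
def litColors (c : ℕ) : Fin 6 → List ℕ :=
  -- After the color `0`, the forced course is dead, alive, then `c` or dead. If `c` is blocked at
  -- the third vertex, dead is forced there, followed by `0`, `1`, `0`: the signal leaves the unit.
  -- Otherwise the unit can end with `1`, which is no signal.
  ![[0, deadColor c], [aliveColor c, deadColor c], [aliveColor c, c, deadColor c],
    [0, deadColor c], [0, 1], [0, 1]]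

/-- The colors allowed at a vertex of a row. -/
def Allowed : Option (Reg X.β X.k) → X.Cell → Fin X.q → Prop
  | none, x, c => c.val = sepColor x.2.1 x.2.2
  | some r, x, c => c.val ∈ litColors (x.1 r.2.2 x.2.1) x.2.2

/-- The vertex is joined to a vertex of the block of the literal: the coloring of the block that
the lane prescribes makes the literal false. -/
def Hit (r : Reg X.β X.k) (x : X.Cell) : Prop :=
  X.dec (x.1 r.2.2) r.2.1 ≠ r.1 ∧ x.2.2 = 2

/-- Parity of the position of a vertex. -/
def odd (x : X.Cell) : Bool := x.2.2.val % 2 == 1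

open Classical in
/-- The edges of a row. -/
noncomputable def rowTerms (κ : Option (Reg X.β X.k)) : List (Term × Term) :=
  -- Counter `0` points at the start of the preceding row, so the current row has offset `D`. The
  -- predecessor of the first cell of a lane is the last cell of that lane in the preceding row.
  let D := Fintype.card X.Lane * (X.p * 6)
  (Finset.univ.toList.map fun x : X.Cell =>
    ((if x.2.1.val = 0 ∧ x.2.2.val = 0 then (X.cellEquiv x + X.p * 6 - 1, 1, 0)
      else (D + X.cellEquiv x - 1, 1, 0)), (D + X.cellEquiv x, 1, 0))) ++
  ((Finset.univ.filter fun y : X.Cell × Fin X.q => ¬ X.Allowed κ y.1 y.2).toList.map fun y =>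
    ((D + X.cellEquiv y.1, 1, 0), (4 * (X.τ (X.odd y.1) y.2).val, 0, 0))) ++
  ((Finset.univ.filter fun x : X.Cell => ∃ r, κ = some r ∧ X.Hit r x).toList.map fun x =>
    ((D + X.cellEquiv x, 1, 0), (4 * (X.h + x.2.1.val), 0, 4 * X.p)))

open Classical in
/-- The constants of the reduction. -/
noncomputable def spec : Spec where
  β := X.β
  p := X.p
  k := X.k
  h := X.h
  D := Fintype.card X.Lane * (X.p * 6)
  fixed := (Finset.univ.filter fun e : Fin X.h × Fin X.h => X.H.Adj e.1 e.2).toList.map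
    fun e => (4 * e.1.val, 4 * e.2.val)
  row := X.rowTerms
  β_pos := X.β_pos

section Graph

variable (φ : CNF)

/-- The vertices that represent the blocks of variables. -/
abbrev Block : Type := Fin (φ.numVars / X.β + 1) × Fin X.p

/-- The modulator. -/
abbrev Mod : Type := Fin X.h ⊕ X.Block φ

/-- The other vertices. -/
abbrev PathVertex : Type := Fin ((X.spec.rows φ).length + 1) × X.Cell

/-- The edges on the paths. -/
def Link (a b : X.PathVertex φ) : Prop :=
  -- Row `0` has no edges inside; it exists only so that the first row of the formula also has
  -- predecessors and all rows follow one pattern.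
  a.2.1 = b.2.1 ∧
    ((a.1 = b.1 ∧ b.1 ≠ 0 ∧ 6 * b.2.2.1.val + b.2.2.2 = 6 * a.2.2.1 + a.2.2.2 + 1) ∨
      (b.1.val = a.1 + 1 ∧ b.2.2.1.val = 0 ∧ b.2.2.2 = 0 ∧ a.2.2.1.val + 1 = X.p ∧ a.2.2.2 = 5))

/-- The edges between a row and the modulator. -/
def RowAtt (r : X.spec.Row) (x : X.Cell) (s : X.Mod φ) : Prop :=
  (∃ c, ¬ X.Allowed r.1 x c ∧ s = .inl (X.τ (X.odd x) c)) ∨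
    ∃ l b, r.1 = some l ∧ X.Hit l x ∧ b.val = r.2 ∧ s = .inr (b, x.2.1)

/-- The edges between the paths and the modulator. -/
def Att (a : X.PathVertex φ) (s : X.Mod φ) : Prop :=
  ∃ i : Fin (X.spec.rows φ).length, a.1 = i.succ ∧ X.RowAtt φ ((X.spec.rows φ).get i) a.2 s

/-- An order of the vertices on the paths. -/
noncomputable def pathEquiv : X.PathVertex φ ≃
    Fin (Fintype.card X.Lane * (((X.spec.rows φ).length + 1) * (X.p * 6))) :=
  (((Equiv.prodAssoc _ _ _).symm.trans (((Equiv.prodComm _ _).prodCongr (Equiv.refl _)).trans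
    (Equiv.prodAssoc _ _ _))).trans ((Fintype.equivFin X.Lane).prodCongr
      (((Equiv.refl _).prodCongr finProdFinEquiv).trans finProdFinEquiv))).trans finProdFinEquiv

theorem pathEquiv_val (a : X.PathVertex φ) : (X.pathEquiv φ a).val =
    a.2.2.2 + 6 * a.2.2.1 + X.p * 6 * a.1 +
      ((X.spec.rows φ).length + 1) * (X.p * 6) * Fintype.equivFin X.Lane a.2.1 := rfl

theorem pathEquiv_link (a b : X.PathVertex φ) (h : X.Link φ a b) :
    (X.pathEquiv φ b).val = (X.pathEquiv φ a).val + 1 := by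
  rw [pathEquiv_val, pathEquiv_val]
  obtain ⟨h₁, ⟨h₂, -, h₃⟩ | ⟨h₂, h₃, h₄, h₅, h₆⟩⟩ := h
  · rw [h₁, h₂]
    omega
  · rw [h₁, h₂, h₃, h₄, h₆]
    simp only [Fin.val_zero, show ((5 : Fin 6) : ℕ) = 5 from rfl]
    linarith

/-- The graph of the reduction. -/
noncomputable def graph : SimpleGraph ((X.Mod φ × Fin 4) ⊕ X.PathVertex φ) :=
  frame (X.H ⊕g ⊥) (fun a => (X.pathEquiv φ a).val) (X.Link φ) (X.pathEquiv_link φ) (X.Att φ)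

/-- Linked cells have opposite parity, also across units and rows because a unit has six cells. They
therefore use different lists of the palette, and at most one of them is a third cell joined to a
block. The neighbors of a single cell in the modulator are independent: one list of the palette and
isolated block vertices. -/
theorem graph_cliqueFree : (X.graph φ).CliqueFree 3 := by
  refine frame_cliqueFree ?_ ?_ ?_
  · have := cliqueFree_three_iff.1 X.H_cliqueFree
    rw [cliqueFree_three_iff]
    rintro (a | a) (b | b) (c | c) h₁ h₂ h₃ <;> simp at h₁ h₂ h₃
    exact this a b c h₁ h₂ h₃
  · rintro a s s' ⟨i, hi, h⟩ ⟨i', -, h'⟩ hss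
    rcases h with ⟨c, -, rfl⟩ | ⟨l, b, -, -, -, rfl⟩ <;>
      rcases h' with ⟨c', -, rfl⟩ | ⟨l', b', -, -, -, rfl⟩ <;> simp at hss
    exact X.τ_not_adj _ _ _ hss
  · rintro a b s hab ⟨i, hi, h⟩ ⟨i', hi', h'⟩
    have hpar : X.odd a.2 ≠ X.odd b.2 := by
      obtain ⟨-, ⟨-, -, h₃⟩ | ⟨-, -, h₄, -, h₆⟩⟩ := hab
      · have : a.2.2.2.val % 2 ≠ b.2.2.2.val % 2 := by omega
        simp only [odd, ne_eq, beq_eq_beq]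
        omega
      · simp [odd, h₄, h₆]
    rcases h with ⟨c, -, rfl⟩ | ⟨l, b', -, h, -, rfl⟩ <;>
      rcases h' with ⟨c', -, h'⟩ | ⟨l', b', -, h', -, e⟩
    · have h' := Sum.inl.inj h'
      cases hb : X.odd b.2 <;> cases ha : X.odd a.2 <;> rw [ha, hb] at h' hpar
      · exact hpar rfl
      · exact X.τ_ne _ _ h'.symm
      · exact X.τ_ne _ _ h'
      · exact hpar rfl
    · simp at e
    · simp at h'
    · simp [odd, h.2, h'.2] at hpar

/-- The number of a modulator vertex. -/
noncomputable def modEquiv : X.Mod φ ≃ Fin (X.h + (φ.numVars / X.β + 1) * X.p) :=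
  ((Equiv.refl _).sumCongr finProdFinEquiv).trans finSumFinEquiv

theorem modEquiv_inl (a : Fin X.h) : (X.modEquiv φ (.inl a)).val = a := rfl

theorem modEquiv_inr (b : X.Block φ) :
    (X.modEquiv φ (.inr b)).val = X.h + (b.2 + X.p * b.1) := rfl

theorem modSize_eq : X.spec.modSize φ = X.h + (φ.numVars / X.β + 1) * X.p := by
  simp [Spec.modSize, spec, mul_comm]

theorem order_eq : (X.h + (φ.numVars / X.β + 1) * X.p) * 4 +
    ((X.spec.rows φ).length + 1) * (Fintype.card X.Lane * (X.p * 6)) = X.spec.order φ := by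
  rw [Spec.order, modSize_eq]
  change _ = _ + Fintype.card X.Lane * (X.p * 6) * _
  ring

/-- The number of a vertex. -/
noncomputable def vertexEquiv : ((X.Mod φ × Fin 4) ⊕ X.PathVertex φ) ≃ Fin (X.spec.order φ) :=
  (((((X.modEquiv φ).prodCongr (Equiv.refl _)).trans finProdFinEquiv).sumCongr
    (((Equiv.refl _).prodCongr X.cellEquiv).trans finProdFinEquiv)).trans finSumFinEquiv).trans
    (finCongr (X.order_eq φ))

theorem vertexEquiv_inl (s : X.Mod φ) (j : Fin 4) :
    (X.vertexEquiv φ (.inl (s, j))).val = j + 4 * X.modEquiv φ s := rfl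

theorem vertexEquiv_inr (a : X.PathVertex φ) : (X.vertexEquiv φ (.inr a)).val =
    4 * X.spec.modSize φ + (X.cellEquiv a.2 + X.spec.D * a.1) := by
  rw [modSize_eq, mul_comm 4]
  rfl

end Graph

end Design

end FineGrained

/-! ### The edge list written by the program describes the graph -/

namespace FineGrained

namespace Design

variable (X : Design) (φ : CNF)

/-- The edges of the graph, in the orientation in which they are listed. -/
def Dir : (X.Mod φ × Fin 4) ⊕ X.PathVertex φ → (X.Mod φ × Fin 4) ⊕ X.PathVertex φ → Prop
  | .inl x, .inl y => (x.1 = y.1 ∧ y.2 = x.2 + 1) ∨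
      (x.2 = 0 ∧ y.2 = 0 ∧ ∃ a b, x.1 = .inl a ∧ y.1 = .inl b ∧ X.H.Adj a b)
  | .inl _, .inr _ => False
  | .inr a, .inl x => x.2 = 0 ∧ X.Att φ a x.1
  | .inr a, .inr b => X.Link φ a b

theorem graph_adj_iff (u v) : (X.graph φ).Adj u v ↔ X.Dir φ u v ∨ X.Dir φ v u := by
  rcases u with ⟨s, i⟩ | a <;> rcases v with ⟨t, j⟩ | b
  · have hsq : ∀ i j : Fin 4, i.val % 2 ≠ j.val % 2 ↔ j = i + 1 ∨ i = j + 1 := by decide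
    have hH : ∀ s t : X.Mod φ, (X.H ⊕g (⊥ : SimpleGraph (X.Block φ))).Adj s t ↔
        ∃ a b, s = .inl a ∧ t = .inl b ∧ X.H.Adj a b := by
      rintro (s | s) (t | t) <;> simp
    change (s = t ∧ i.val % 2 ≠ j.val % 2) ∨ (i = 0 ∧ j = 0 ∧ _) ↔
      ((s = t ∧ j = i + 1) ∨ (i = 0 ∧ j = 0 ∧ _)) ∨ ((t = s ∧ i = j + 1) ∨ (j = 0 ∧ i = 0 ∧ _))
    simp only [← hH, hsq, eq_comm (a := t) (b := s), SimpleGraph.adj_comm _ t s]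
    tauto
  · exact (iff_of_eq (false_or _)).symm
  · exact (iff_of_eq (or_false _)).symm
  · exact Iff.rfl

theorem mem_squares_iff (e : ℕ × ℕ) : e ∈ Spec.squares (X.spec.modSize φ) ↔
    ∃ s j, e = ((X.vertexEquiv φ (.inl (s, j))).val, (X.vertexEquiv φ (.inl (s, j + 1))).val) := by
  have key : ∀ s, e ∈ edgesAt (4 * s) 0 Spec.square ↔
      ∃ j : Fin 4, e = (j.val + 4 * s, (j + 1).val + 4 * s) := by
    intro s
    simp only [edgesAt, Spec.square, List.map_cons, List.map_nil, List.mem_cons, Term.val,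
      List.not_mem_nil, or_false, zero_mul, add_zero, one_mul]
    constructor
    · rintro (rfl | rfl | rfl | rfl)
      exacts [⟨0, rfl⟩, ⟨1, rfl⟩, ⟨2, rfl⟩, ⟨3, rfl⟩]
    · rintro ⟨j, rfl⟩
      fin_cases j
      exacts [.inl rfl, .inr (.inl rfl), .inr (.inr (.inl rfl)), .inr (.inr (.inr rfl))]
  simp only [Spec.mem_squares, vertexEquiv_inl, key, modSize_eq]
  exact ⟨fun ⟨s, hs, h⟩ => ⟨(X.modEquiv φ).symm ⟨s, hs⟩, by simpa using h⟩,
    fun ⟨s, h⟩ => ⟨X.modEquiv φ s, (X.modEquiv φ s).2, h⟩⟩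

theorem mem_fixed_iff (e : ℕ × ℕ) : e ∈ X.spec.fixed ↔ ∃ a b, X.H.Adj a b ∧
    e = ((X.vertexEquiv φ (.inl (.inl a, 0))).val, (X.vertexEquiv φ (.inl (.inl b, 0))).val) := by
  have : ∀ a, (X.vertexEquiv φ (.inl (.inl a, 0))).val = 4 * a.val := fun a => by
    rw [vertexEquiv_inl, modEquiv_inl, Fin.val_zero, zero_add]
  simp only [this]
  simp only [spec, List.mem_map, Finset.mem_toList, Finset.mem_filter, Finset.mem_univ, true_and,
    Prod.exists, eq_comm]

theorem snd_lt_of_mem_rows (r : X.spec.Row) (hr : r ∈ X.spec.rows φ) :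
    r.2 < φ.numVars / X.β + 1 := by
  have hlit : ∀ ls : List (Fin φ.numVars × Bool), ∀ r ∈ X.spec.litRows ls,
      r.2 < φ.numVars / X.β + 1 := by
    intro ls
    induction ls with
    | nil => simp [Spec.litRows]
    | cons l ls ih =>
      rintro r hr
      rcases List.mem_cons.1 hr with rfl | hr
      · exact Nat.lt_succ_of_le (Nat.div_le_div_right l.1.2.le)
      · exact ih r hr
  simp only [Spec.rows, Spec.clauseRows, List.mem_append, List.mem_flatMap, List.mem_cons,
    List.not_mem_nil, or_false] at hr
  rcases hr with ⟨C, -, rfl | hr⟩ | rfl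
  · exact Nat.succ_pos _
  · exact hlit C r hr
  · exact Nat.succ_pos _

theorem mem_row_iff (i : Fin (X.spec.rows φ).length) (e : ℕ × ℕ) :
    e ∈ edgesAt (4 * X.spec.modSize φ + X.spec.D * i) ((X.spec.rows φ).get i).2
      (X.spec.row ((X.spec.rows φ).get i).1) ↔
    (∃ a b, X.Link φ a b ∧ b.1 = i.succ ∧
      e = ((X.vertexEquiv φ (.inr a)).val, (X.vertexEquiv φ (.inr b)).val)) ∨
    ∃ x s, X.RowAtt φ ((X.spec.rows φ).get i) x s ∧
      e = ((X.vertexEquiv φ (.inr (i.succ, x))).val, (X.vertexEquiv φ (.inl (s, 0))).val) := by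
  have hD : X.spec.D = Fintype.card X.Lane * (X.p * 6) := rfl
  set r := (X.spec.rows φ).get i with hr
  set c := 4 * X.spec.modSize φ with hc
  have hnum : ∀ x, (X.vertexEquiv φ (.inr (i.succ, x))).val =
      Term.val (c + X.spec.D * i) r.2 (X.spec.D + X.cellEquiv x, 1, 0) := by
    intro x
    simp only [vertexEquiv_inr, Term.val, Fin.val_succ]
    ring
  have hmod : ∀ s : X.Mod φ, (X.vertexEquiv φ (.inl (s, 0))).val = 4 * X.modEquiv φ s := by
    intro s
    simp [vertexEquiv_inl]
  have hpath : ∀ x : X.Cell, ∃ a, X.Link φ a (i.succ, x) ∧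
      (X.vertexEquiv φ (.inr a)).val = Term.val (c + X.spec.D * i) r.2
        (if x.2.1.val = 0 ∧ x.2.2.val = 0 then (X.cellEquiv x + X.p * 6 - 1, 1, 0)
          else (X.spec.D + X.cellEquiv x - 1, 1, 0)) := by
    rintro ⟨u, a, j⟩
    have hp := X.one_le_p
    split_ifs with h
    · refine ⟨(i.castSucc, u, ⟨X.p - 1, by omega⟩, 5), ⟨rfl, .inr ⟨by simp, h.1, Fin.ext h.2, ?_,
        rfl⟩⟩, ?_⟩
      · simp only
        omega
      · simp only at h
        simp only [vertexEquiv_inr, cellEquiv_val, Term.val, h.1, h.2, Fin.val_castSucc,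
          show ((5 : Fin 6) : ℕ) = 5 from rfl]
        omega
    · simp only at h
      have hj := j.2
      have ha := a.2
      refine ⟨(i.succ, u, ⟨(6 * a + j - 1) / 6, by omega⟩, ⟨(6 * a + j - 1) % 6, by omega⟩),
        ⟨rfl, .inl ⟨rfl, Fin.succ_ne_zero i, ?_⟩⟩, ?_⟩
      · simp only
        omega
      · simp only [vertexEquiv_inr, cellEquiv_val, Term.val, Fin.val_succ, mul_add, mul_one]
        omega
  have hlink : ∀ a x, X.Link φ a (i.succ, x) → (X.vertexEquiv φ (.inr a)).val =
      Term.val (c + X.spec.D * i) r.2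
        (if x.2.1.val = 0 ∧ x.2.2.val = 0 then (X.cellEquiv x + X.p * 6 - 1, 1, 0)
          else (X.spec.D + X.cellEquiv x - 1, 1, 0)) := by
    intro a x h
    obtain ⟨a', h', e'⟩ := hpath x
    -- A link raises `pathEquiv` by one, so a cell has only one predecessor.
    have : a = a' := (X.pathEquiv φ).injective (Fin.ext (by
      have := X.pathEquiv_link φ _ _ h
      have := X.pathEquiv_link φ _ _ h'
      omega))
    rw [this, e']
  have hblock : ∀ (b : Fin (φ.numVars / X.β + 1)) (y : Fin X.p), b.val = r.2 →
      (X.vertexEquiv φ (.inl (.inr (b, y), 0))).val =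
        Term.val (c + X.spec.D * i) r.2 (4 * (X.h + y.val), 0, 4 * X.p) := by
    intro b y hb
    rw [hmod, modEquiv_inr, Term.val, hb]
    ring
  have hpal : ∀ s : Fin X.h, (X.vertexEquiv φ (.inl (.inl s, 0))).val =
      Term.val (c + X.spec.D * i) r.2 (4 * s.val, 0, 0) := by
    intro s
    simp [hmod, modEquiv_inl, Term.val]
  change e ∈ edgesAt _ _ (X.rowTerms _) ↔ _
  simp only [edgesAt, rowTerms, List.map_append, List.map_map, List.mem_append, List.mem_map,
    Finset.mem_toList, Finset.mem_filter, Finset.mem_univ, true_and, Function.comp, or_assoc]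
  simp only [← hD]
  refine or_congr ?_ ?_
  · constructor
    · rintro ⟨x, rfl⟩
      obtain ⟨a, h, e⟩ := hpath x
      exact ⟨a, (i.succ, x), h, rfl, Prod.ext e.symm (hnum x).symm⟩
    · rintro ⟨a, ⟨_, x⟩, h, rfl, rfl⟩
      exact ⟨x, Prod.ext (hlink a x h).symm (hnum x).symm⟩
  · constructor
    · rintro (⟨⟨x, col⟩, h, rfl⟩ | ⟨x, ⟨l, hl, h⟩, rfl⟩)
      · exact ⟨x, _, .inl ⟨col, h, rfl⟩, Prod.ext (hnum x).symm (hpal _).symm⟩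
      · have hb := X.snd_lt_of_mem_rows φ r (List.get_mem _ _)
        exact ⟨x, _, .inr ⟨l, ⟨r.2, hb⟩, hl, h, rfl, rfl⟩,
          Prod.ext (hnum x).symm (hblock _ _ rfl).symm⟩
    · rintro ⟨x, s, ⟨col, h, rfl⟩ | ⟨l, b, hl, h, hb, rfl⟩, rfl⟩
      · exact .inl ⟨(x, col), h, Prod.ext (hnum x).symm (hpal _).symm⟩
      · exact .inr ⟨x, ⟨l, hl, h⟩, Prod.ext (hnum x).symm (hblock _ _ hb).symm⟩

theorem mem_edgeList_iff (e : ℕ × ℕ) : e ∈ X.spec.edgeList φ ↔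
    ∃ u v, X.Dir φ u v ∧ e = ((X.vertexEquiv φ u).val, (X.vertexEquiv φ v).val) := by
  rw [Spec.edgeList, List.mem_append, List.mem_append, mem_fixed_iff, mem_squares_iff,
    Spec.mem_rowEdges]
  simp only [mem_row_iff]
  constructor
  · rintro (⟨i, ⟨a, b, h, -, e⟩ | ⟨x, s, h, e⟩⟩ | ⟨a, b, h, e⟩ | ⟨s, j, e⟩)
    · exact ⟨.inr a, .inr b, h, e⟩
    · exact ⟨.inr (i.succ, x), .inl (s, 0), ⟨rfl, i, rfl, h⟩, e⟩
    · exact ⟨.inl (.inl a, 0), .inl (.inl b, 0), .inr ⟨rfl, rfl, a, b, rfl, rfl, h⟩, e⟩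
    · exact ⟨.inl (s, j), .inl (s, j + 1), .inl ⟨rfl, rfl⟩, e⟩
  · rintro ⟨⟨s, i⟩ | a, ⟨t, j⟩ | b, h, rfl⟩
    · rcases h with ⟨h₁, h₂⟩ | ⟨h₁, h₂, a, b, h₃, h₄, h⟩
      · simp only at h₁ h₂
        subst h₁ h₂
        exact .inr (.inr ⟨s, i, rfl⟩)
      · simp only at h₁ h₂ h₃ h₄
        subst h₁ h₂ h₃ h₄
        exact .inr (.inl ⟨a, b, h, rfl⟩)
    · exact h.elim
    · obtain ⟨h₁, i, h₂, h⟩ := h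
      obtain ⟨a₁, x⟩ := a
      simp only at h₁ h₂ h
      subst h₁ h₂
      exact .inl ⟨i, .inr ⟨x, t, h, rfl⟩⟩
    · have hb : b.1 ≠ 0 := by
        rcases h.2 with h | h
        · exact h.2.1
        · intro hb
          have := h.1
          rw [hb] at this
          simp at this
      obtain ⟨i, hi⟩ := Fin.exists_succ_eq.2 hb
      exact .inl ⟨i, .inl ⟨a, b, h, hi.symm, rfl⟩⟩

theorem lt_order_of_mem_edgeList {e : ℕ × ℕ} (he : e ∈ X.spec.edgeList φ) :
    e.1 < X.spec.order φ ∧ e.2 < X.spec.order φ := by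
  obtain ⟨u, v, -, rfl⟩ := (X.mem_edgeList_iff φ e).1 he
  exact ⟨(X.vertexEquiv φ u).2, (X.vertexEquiv φ v).2⟩

/-- The graph of the reduction as an input word presents it. -/
noncomputable def graphInput : GraphInput where
  n := X.spec.order φ
  graph := (X.graph φ).map (X.vertexEquiv φ).toEmbedding
  edges := (X.spec.edgeList φ).attach.map fun e =>
    (⟨e.1.1, (X.lt_order_of_mem_edgeList φ e.2).1⟩, ⟨e.1.2, (X.lt_order_of_mem_edgeList φ e.2).2⟩)
  adj_iff u v := by
    obtain ⟨u, rfl⟩ := (X.vertexEquiv φ).surjective u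
    obtain ⟨v, rfl⟩ := (X.vertexEquiv φ).surjective v
    have key : ∀ u v, X.Dir φ u v ↔ (X.vertexEquiv φ u, X.vertexEquiv φ v) ∈
        (X.spec.edgeList φ).attach.map fun e => (
          (⟨e.1.1, (X.lt_order_of_mem_edgeList φ e.2).1⟩ : Fin (X.spec.order φ)),
          (⟨e.1.2, (X.lt_order_of_mem_edgeList φ e.2).2⟩ : Fin (X.spec.order φ))) := by
      intro u v
      rw [List.mem_map]
      constructor
      · exact fun h => ⟨⟨_, (X.mem_edgeList_iff φ _).2 ⟨u, v, h, rfl⟩⟩, List.mem_attach _ _, rfl⟩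
      · rintro ⟨⟨e, he⟩, -, h⟩
        obtain ⟨u', v', h', rfl⟩ := (X.mem_edgeList_iff φ _).1 he
        obtain ⟨h₁, h₂⟩ := Prod.ext_iff.1 h
        rwa [← (X.vertexEquiv φ).injective h₁, ← (X.vertexEquiv φ).injective h₂]
    rw [← key, ← key, ← graph_adj_iff]
    exact SimpleGraph.map_adj_apply

/-- The graph and its presentation are isomorphic. -/
noncomputable def graphIso : X.graph φ ≃g (X.graphInput φ).graph :=
  SimpleGraph.Iso.map (X.vertexEquiv φ) (X.graph φ)

theorem graphInput_cliqueFree : (X.graphInput φ).graph.CliqueFree 3 :=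
  (X.graph_cliqueFree φ).comap ⟨(X.graphIso φ).symm.toHom, (X.graphIso φ).symm.injective⟩

theorem graphInput_colorable :
    (X.graphInput φ).graph.Colorable X.q ↔ (X.graph φ).Colorable X.q :=
  ⟨fun h => h.of_hom (X.graphIso φ).toHom, fun h => h.of_hom (X.graphIso φ).symm.toHom⟩

/-- Equality is needed, not just a bound: the word of an instance contains the distance, and the
program writes `modSize`. -/
theorem caterpillarDist_graphInput :
    caterpillarDist (X.graphInput φ).graph = X.spec.modSize φ := by
  have h := caterpillarDist_frame (V := Fin (X.spec.order φ)) (X.graphIso φ) (fun a b hab =>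
    (X.pathEquiv φ).injective (Fin.ext hab))
  rw [modSize_eq]
  exact h.trans (by simp)

theorem encode_graphInput :
    (triangleFreeColoring X.q).encode ⟨X.graphInput φ, X.graphInput_cliqueFree φ⟩ =
      X.spec.output φ := by
  change unary _ ++ unary (caterpillarDist (X.graphInput φ).graph) ++ _ = _
  rw [caterpillarDist_graphInput]
  refine congrArg₂ _ rfl ?_
  rw [encEdges, ← List.attach_map_subtype_val (X.spec.edgeList φ)]
  simp only [graphInput, List.flatMap_map]
  simp [encodeEdge]

end Design

end FineGrained

/-! ### Signals, and soundness: a coloring yields a satisfying assignment -/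

namespace FineGrained

namespace Design

variable (X : Design)

section Signal

variable (y : ℕ → Fin X.p → Fin X.q) (F : X.Lane)

/-- The signal passes a unit of the row of a literal. -/
def Pass (l : Reg X.β X.k) (b : ℕ) (u : Fin X.p) : Prop :=
  X.dec (F l.2.2) l.2.1 ≠ l.1 ∧ y b u = F l.2.2 u

/-- The signal after a row, in terms of the signal before: it starts at a separator, and can stop
at a literal. -/
def step (s : Prop) (r : X.spec.Row) : Prop := ∀ l ∈ r.1, s ∧ ∀ u, X.Pass y F l r.2 u

/-- The signal after a list of rows. -/
def signal (s : Prop) (rs : List X.spec.Row) : Prop := rs.foldl (X.step y F) s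

variable {y F}

theorem signal_append (s : Prop) (rs rs' : List X.spec.Row) :
    X.signal y F s (rs ++ rs') = X.signal y F (X.signal y F s rs) rs' :=
  List.foldl_append

theorem signal_separator (s : Prop) (b : ℕ) (rs : List X.spec.Row) :
    X.signal y F s ((none, b) :: rs) = X.signal y F True rs := by
  have : X.step y F s (none, b) = True := eq_true fun l hl => by simp at hl
  rw [signal, List.foldl_cons, this, signal]

theorem signal_litRows {n : ℕ} (s : Prop) (ls : List (Fin n × Bool)) :
    X.signal y F s (X.spec.litRows ls) ↔ s ∧ ∀ r ∈ X.spec.litRows ls, ∀ l ∈ r.1, ∀ u,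
      X.Pass y F l r.2 u := by
  induction ls generalizing s with
  | nil => simp [Spec.litRows, signal]
  | cons l ls ih =>
    rw [Spec.litRows, signal, List.foldl_cons, ← signal, ih, List.forall_mem_cons, ← and_assoc]
    refine and_congr_left' ?_
    simp [step]

theorem signal_take_succ (s : Prop) (rs : List X.spec.Row) (i : ℕ) (hi : i < rs.length) :
    X.signal y F s (rs.take (i + 1)) = X.step y F (X.signal y F s (rs.take i)) rs[i] := by
  rw [List.take_succ_eq_append_getElem hi, signal_append]
  rfl

end Signal

/-- The colorings of the graph, after a permutation of the colors. -/
structure Valid (φ : CNF) (y : ℕ → Fin X.p → Fin X.q) (x : X.PathVertex φ → Fin X.q) : Prop where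
  link : ∀ a b, X.Link φ a b → x a ≠ x b
  allowed : ∀ (i : Fin (X.spec.rows φ).length) c,
    X.Allowed ((X.spec.rows φ).get i).1 c (x (i.succ, c))
  hit : ∀ (i : Fin (X.spec.rows φ).length) c, ∀ l ∈ ((X.spec.rows φ).get i).1, X.Hit l c →
    x (i.succ, c) ≠ y ((X.spec.rows φ).get i).2 c.2.1

/-- The coloring of the palette is unique up to a permutation of the colors. Undoing this
permutation turns the edges to the palette into the lists `Allowed`. -/
theorem graph_colorable_iff (φ : CNF) :
    (X.graph φ).Colorable X.q ↔ ∃ y x, X.Valid φ y x := by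
  have hq := X.three_le_q
  rw [graph, frame_colorable (by omega)]
  constructor
  · rintro ⟨cS, cQ, hlink, hatt⟩
    obtain ⟨π, hπ⟩ := X.coloring_unique
      (SimpleGraph.Coloring.mk (fun a => cS (.inl a)) fun {a b} h => cS.valid (by simpa using h))
    refine ⟨fun b u => if h : b < φ.numVars / X.β + 1 then π.symm (cS (.inr (⟨b, h⟩, u)))
      else ⟨0, by omega⟩, fun a => π.symm (cQ a), fun a b h e => hlink a b h (π.symm.injective e),
      fun i c => ?_, fun i c l hl h => ?_⟩
    · by_contra hc
      refine hatt (i.succ, c) _ ⟨i, rfl, .inl ⟨_, hc, rfl⟩⟩ ?_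
      have := hπ (X.odd c) (π.symm (cQ (i.succ, c)))
      rw [Equiv.apply_symm_apply] at this
      exact this.symm
    · have hb := X.snd_lt_of_mem_rows φ _ (List.get_mem (X.spec.rows φ) i)
      rw [dif_pos hb]
      exact fun e => hatt (i.succ, c) _ ⟨i, rfl, .inr ⟨l, ⟨_, hb⟩, hl, h, rfl, rfl⟩⟩
        (π.symm.injective e)
  · rintro ⟨y, x, h⟩
    obtain ⟨c, hc⟩ := X.exists_coloring
    refine ⟨SimpleGraph.Coloring.mk (Sum.elim c fun b => y b.1 b.2) ?_, x, h.link, ?_⟩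
    · rintro (a | a) (b | b) hab <;> simp at hab
      exact c.valid hab
    · rintro ⟨_, a⟩ s ⟨i, rfl, ⟨col, hcol, rfl⟩ | ⟨l, b, hl, hit, hb, rfl⟩⟩ e
      · refine hcol ?_
        have : x (i.succ, a) = col := e.trans (hc _ _)
        rw [← this]
        exact h.allowed i a
      · refine h.hit i a l hl hit ?_
        rw [← hb]
        exact e

theorem aliveColor_ne_self (c : ℕ) : aliveColor c ≠ c := by
  unfold aliveColor
  split_ifs <;> omega

theorem deadColor_ne_self (c : ℕ) : deadColor c ≠ c := by
  unfold deadColor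
  split_ifs <;> omega

theorem deadColor_ne_zero (c : ℕ) : deadColor c ≠ 0 := by
  unfold deadColor
  split_ifs <;> omega

theorem aliveColor_ne_deadColor (c : ℕ) : aliveColor c ≠ deadColor c := by
  unfold aliveColor deadColor
  split_ifs <;> omega

section Soundness

variable {X} {φ : CNF} {y : ℕ → Fin X.p → Fin X.q} {x : X.PathVertex φ → Fin X.q}

/-- The last unit of a row. -/
def lastUnit (X : Design) : Fin X.p := ⟨X.p - 1, Nat.sub_one_lt (Nat.one_le_iff_ne_zero.1 X.one_le_p)⟩

theorem Valid.link_last (h : X.Valid φ y x) (F : X.Lane) (i : Fin (X.spec.rows φ).length)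
    (u : Fin X.p) (hu : u.val = 0) :
    x (i.castSucc, F, X.lastUnit, 5) ≠ x (i.succ, F, u, 0) := by
  have := X.one_le_p
  refine h.link _ _ ⟨rfl, .inr ⟨by simp, hu, rfl, ?_, rfl⟩⟩
  simp only [lastUnit]
  omega

theorem Valid.link_unit (h : X.Valid φ y x) (F : X.Lane) (i : Fin (X.spec.rows φ).length)
    (u : Fin X.p) (j j' : Fin 6) (hj : j'.val = j + 1) :
    x (i.succ, F, u, j) ≠ x (i.succ, F, u, j') := by
  refine h.link _ _ ⟨rfl, .inl ⟨rfl, Fin.succ_ne_zero i, ?_⟩⟩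
  simp only
  omega

/-- Each color is forced by the one before: dead, alive, dead, `0`, `1`, `0`. -/
theorem unit_signal {c : ℕ} {v : Fin 6 → ℕ} (hv : ∀ j, v j ∈ litColors c j) (h₀ : v 0 ≠ 0)
    (hne : ∀ j j' : Fin 6, j'.val = j + 1 → v j ≠ v j') (h₂ : v 2 ≠ c) : v 5 = 0 := by
  have a₀ : v 0 ∈ [0, deadColor c] := hv 0
  have a₁ : v 1 ∈ [aliveColor c, deadColor c] := hv 1
  have a₂ : v 2 ∈ [aliveColor c, c, deadColor c] := hv 2
  have a₃ : v 3 ∈ [0, deadColor c] := hv 3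
  have a₄ : v 4 ∈ [0, 1] := hv 4
  have a₅ : v 5 ∈ [0, 1] := hv 5
  have n₀ := hne 0 1 rfl
  have n₁ := hne 1 2 rfl
  have n₂ := hne 2 3 rfl
  have n₃ := hne 3 4 rfl
  have n₄ := hne 4 5 rfl
  simp only [List.mem_cons, List.not_mem_nil, or_false] at a₀ a₁ a₂ a₃ a₄ a₅
  have b₀ := a₀.resolve_left h₀
  have b₁ := a₁.resolve_right fun e => n₀ (b₀.trans e.symm)
  have b₂ := (a₂.resolve_left fun e => n₁ (b₁.trans e.symm)).resolve_left h₂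
  have b₃ := a₃.resolve_right fun e => n₂ (b₂.trans e.symm)
  omega

theorem Valid.step (h : X.Valid φ y x) (F : X.Lane) (i : Fin (X.spec.rows φ).length)
    (hs : X.step y F ((x (i.castSucc, F, X.lastUnit, 5)).val = 0) ((X.spec.rows φ).get i)) :
    (x (i.succ, F, X.lastUnit, 5)).val = 0 := by
  have hall := h.allowed i
  have hhit := h.hit i
  rcases hr : (X.spec.rows φ).get i with ⟨_ | l, b⟩ <;> rw [hr] at hall hhit hs
  · have := hall (F, X.lastUnit, 5)
    simp only [Allowed, sepColor] at this
    rw [this]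
    split_ifs <;> rfl
  · obtain ⟨h₀, hpass⟩ := hs l rfl
    have key : ∀ n (hn : n < X.p), (x (i.succ, F, ⟨n, hn⟩, 5)).val = 0 := by
      intro n
      induction n with
      | zero =>
        intro hn
        refine unit_signal (c := F l.2.2 ⟨0, hn⟩) (v := fun j => (x (i.succ, F, ⟨0, hn⟩, j)).val)
          (fun j => hall (F, ⟨0, hn⟩, j)) ?_ ?_ ?_
        · exact fun e => h.link_last F i ⟨0, hn⟩ rfl (Fin.ext (h₀.trans e.symm))
        · exact fun j j' hj e => h.link_unit F i _ j j' hj (Fin.ext e)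
        · intro e
          refine hhit (F, ⟨0, hn⟩, 2) l rfl ⟨(hpass ⟨0, hn⟩).1, rfl⟩ ?_
          rw [(hpass ⟨0, hn⟩).2]
          exact Fin.ext e
      | succ n ih =>
        intro hn
        refine unit_signal (c := F l.2.2 ⟨n + 1, hn⟩)
          (v := fun j => (x (i.succ, F, ⟨n + 1, hn⟩, j)).val)
          (fun j => hall (F, ⟨n + 1, hn⟩, j)) ?_ ?_ ?_
        · exact fun e => h.link (i.succ, F, ⟨n, by omega⟩, 5) (i.succ, F, ⟨n + 1, hn⟩, 0)
            ⟨rfl, .inl ⟨rfl, Fin.succ_ne_zero i, by simp only [Fin.val_zero,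
              show ((5 : Fin 6) : ℕ) = 5 from rfl]; omega⟩⟩
            (Fin.ext ((ih (by omega)).trans e.symm))
        · exact fun j j' hj e => h.link_unit F i _ j j' hj (Fin.ext e)
        · intro e
          refine hhit (F, ⟨n + 1, hn⟩, 2) l rfl ⟨(hpass ⟨n + 1, hn⟩).1, rfl⟩ ?_
          rw [(hpass ⟨n + 1, hn⟩).2]
          exact Fin.ext e
    exact key _ _

/-- A signal that is due by the rules of `step` really appears as color `0` at the end of the row;
there it conflicts with the color `0` of the first cell of the separator. -/
theorem Valid.not_signal (h : X.Valid φ y x) (F : X.Lane) {rs rs' : List X.spec.Row} {b : ℕ}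
    (hrs : X.spec.rows φ = rs ++ (none, b) :: rs') : ¬ X.signal y F False rs := by
  have key : ∀ i (hi : i < (X.spec.rows φ).length + 1),
      X.signal y F False ((X.spec.rows φ).take i) →
        (x (⟨i, hi⟩, F, X.lastUnit, 5)).val = 0 := by
    intro i
    induction i with
    | zero => exact fun _ h => h.elim
    | succ i ih =>
      intro hi hs
      rw [X.signal_take_succ _ _ _ (by omega)] at hs
      exact h.step F ⟨i, by omega⟩ fun l hl => ⟨ih (by omega) (hs l hl).1, (hs l hl).2⟩
  intro hs
  have hi : rs.length < (X.spec.rows φ).length := by simp [hrs]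
  have h₀ := key rs.length (by omega) (by rwa [hrs, List.take_left' rfl])
  have hall := h.allowed ⟨rs.length, hi⟩ (F, ⟨0, X.one_le_p⟩, 0)
  have hget : (X.spec.rows φ).get ⟨rs.length, hi⟩ = (none, b) := by simp [hrs]
  rw [hget] at hall
  exact h.link_last F ⟨rs.length, hi⟩ ⟨0, X.one_le_p⟩ rfl (Fin.ext (h₀.trans hall.symm))

theorem exists_of_mem_litRows (R : Spec) {n : ℕ} {ls : List (Fin n × Bool)} {r : R.Row}
    (hr : r ∈ R.litRows ls) : ∃ (j : ℕ) (hj : j < ls.length),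
      r = (some (R.reg ls[j].2 ls[j].1 (ls.length - j)), ls[j].1 / R.β) := by
  induction ls with
  | nil => simp [Spec.litRows] at hr
  | cons l ls ih =>
    rcases List.mem_cons.1 hr with rfl | hr
    · exact ⟨0, by simp, rfl⟩
    · obtain ⟨j, hj, rfl⟩ := ih hr
      exact ⟨j + 1, by simpa using hj, by simp⟩

theorem Valid.satisfiable (h : X.Valid φ y x) (hφ : φ.WidthLE X.k) : φ.Satisfiable := by
  refine ⟨fun v => X.dec (y (v / X.β)) (X.spec.offset v), fun C hC => ?_⟩
  by_contra! hsat
  obtain ⟨A, B, hAB⟩ := List.append_of_mem hC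
  obtain ⟨b, rs', hB⟩ : ∃ b rs', X.spec.clauseRows B ++ [(none, 0)] = (none, b) :: rs' := by
    cases B with
    | nil => exact ⟨0, [], rfl⟩
    | cons c B => exact ⟨0, _, rfl⟩
  -- The lane that guesses right everywhere in the violated clause `C`. Its index `r` is the number
  -- of literals still to be read, so the literal in question has position `C.length - r`.
  refine h.not_signal (fun r => if hr : C.length - r < C.length then y (C[C.length - r].1 / X.β)
    else y 0) (rs := X.spec.clauseRows A ++ (none, 0) :: X.spec.litRows C) (rs' := rs') (b := b) ?_ ?_
  · rw [Spec.rows, hAB, ← hB]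
    simp [Spec.clauseRows]
  · rw [signal_append, signal_separator, signal_litRows]
    refine ⟨trivial, fun r hr l hl u => ?_⟩
    obtain ⟨j, hj, rfl⟩ := exists_of_mem_litRows X.spec hr
    have hk := hφ C hC
    obtain rfl := Option.mem_some_iff.1 hl
    have hval : ((X.spec.cap (C.length - j) : Fin (X.k + 1)) : ℕ) = C.length - j :=
      min_eq_left (show _ ≤ X.k by omega)
    have hF : (if hr : C.length - (X.spec.cap (C.length - j) : Fin (X.k + 1)).val < C.length then
        y (C[C.length - (X.spec.cap (C.length - j) : Fin (X.k + 1)).val].1 / X.β) else y 0) =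
        y (C[j].1 / X.β) := by
      have e : C.length - (X.spec.cap (C.length - j) : Fin (X.k + 1)).val = j := by omega
      simp only [e, hj, dif_pos]
    exact ⟨fun e => hsat _ (List.getElem_mem hj)
      ((congrArg (fun f => X.dec f (X.spec.offset C[j].1)) hF).symm.trans e), (congrFun hF u).symm⟩

end Soundness

end Design

end FineGrained

/-! ### Completeness: a satisfying assignment yields a coloring -/

namespace FineGrained

namespace Design

open Classical in
/-- The colors of a unit that tests for the color `c`: whether there is a signal before and after
the unit, whether the unit is joined to the modulator, and the color of the modulator vertex. -/
noncomputable def unitColor (a a' g : Prop) (c z : ℕ) : Fin 6 → ℕ :=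
  ![if a then deadColor c else 0, if a then aliveColor c else deadColor c,
    if a then (if a' then deadColor c else c) else if g ∧ z = aliveColor c then c else aliveColor c,
    if a' then 0 else deadColor c, if a' then 1 else 0, if a' then 0 else 1]

theorem unitColor_mem (a a' g : Prop) (c z : ℕ) (j : Fin 6) :
    unitColor a a' g c z j ∈ litColors c j := by
  fin_cases j <;> simp only [unitColor, litColors, Fin.zero_eta, Fin.mk_one, Fin.reduceFinMk,
    Matrix.cons_val] <;> split_ifs <;> simp

theorem unitColor_ne {a a' g : Prop} (h : a' → a) (c z : ℕ) (j j' : Fin 6) (hj : j'.val = j + 1) :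
    unitColor a a' g c z j ≠ unitColor a a' g c z j' := by
  have h₁ := aliveColor_ne_self c
  have h₂ := deadColor_ne_self c
  have h₃ := deadColor_ne_zero c
  have h₄ := aliveColor_ne_deadColor c
  have key : ∀ v : Fin 6 → ℕ, v 0 ≠ v 1 → v 1 ≠ v 2 → v 2 ≠ v 3 → v 3 ≠ v 4 → v 4 ≠ v 5 →
      v j ≠ v j' := by
    intro v _ _ _ _ _
    fin_cases j <;> fin_cases j' <;> first | assumption | simp at hj
  apply key <;> simp only [unitColor, Matrix.cons_val] <;> split_ifs <;> first | omega | tauto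

/-- Without an incoming signal, alive and `c` are both possible at the third cell and differ, so one
of them avoids `z`. With a signal, `c` works unless `z = c`, which is exactly when the signal is let
through. -/
theorem unitColor_two_ne {a a' g : Prop} {c z : ℕ} (h : a' ↔ a ∧ g ∧ z = c) (hg : g) :
    unitColor a a' g c z 2 ≠ z := by
  have h₁ := aliveColor_ne_self c
  have h₂ := deadColor_ne_self c
  simp only [unitColor, Matrix.cons_val]
  split_ifs <;> grind

theorem litColors_lt {q c : ℕ} (hq : 3 ≤ q) (hc : c < q) (j : Fin 6) :
    ∀ m ∈ litColors c j, m < q := by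
  have h₁ : aliveColor c < q := by
    unfold aliveColor
    split_ifs <;> omega
  have h₂ : deadColor c < q := by
    unfold deadColor
    split_ifs <;> omega
  fin_cases j <;> simp [litColors, h₁, h₂, hc] <;> omega

theorem sepColor_lt (u : ℕ) (j : Fin 6) : sepColor u j < 3 := by
  unfold sepColor
  split_ifs <;> fin_cases j <;> simp

variable (X : Design) {y : ℕ → Fin X.p → Fin X.q} {F : X.Lane}

/-- The color of a vertex of a row, in terms of the signal before the row. -/
noncomputable def cellColor (y : ℕ → Fin X.p → Fin X.q) (s : Prop) (r : Option (Reg X.β X.k) × ℕ) (c : X.Cell) :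
    ℕ :=
  match r.1 with
  | none => sepColor c.2.1 c.2.2
  | some l => unitColor (s ∧ ∀ u < c.2.1, X.Pass y c.1 l r.2 u) (s ∧ ∀ u ≤ c.2.1, X.Pass y c.1 l r.2 u)
      (X.dec (c.1 l.2.2) l.2.1 ≠ l.1) (c.1 l.2.2 c.2.1) (y r.2 c.2.1) c.2.2

theorem cellColor_some (s : Prop) (l : Reg X.β X.k) (b : ℕ) (u : Fin X.p) (j : Fin 6) :
    X.cellColor y s (some l, b) (F, u, j) = unitColor (s ∧ ∀ v < u, X.Pass y F l b v)
      (s ∧ ∀ v ≤ u, X.Pass y F l b v) (X.dec (F l.2.2) l.2.1 ≠ l.1) (F l.2.2 u) (y b u) j := rfl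

theorem cellColor_lt (s : Prop) (r : Option (Reg X.β X.k) × ℕ) (c : X.Cell) : X.cellColor y s r c < X.q := by
  rcases r with ⟨_ | l, b⟩
  · exact (sepColor_lt _ _).trans_le X.three_le_q
  · exact litColors_lt X.three_le_q (c.1 _ _).2 _ _ (unitColor_mem _ _ _ _ _ _)

theorem allowed_cellColor (s : Prop) (r : Option (Reg X.β X.k) × ℕ) (c : X.Cell) :
    X.Allowed r.1 c ⟨X.cellColor y s r c, X.cellColor_lt s r c⟩ := by
  rcases r with ⟨_ | l, b⟩
  · rfl
  · exact unitColor_mem _ _ _ _ _ _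

theorem cellColor_ne_of_hit (s : Prop) (r : Option (Reg X.β X.k) × ℕ) (c : X.Cell) (l : Reg X.β X.k)
    (hl : l ∈ r.1) (h : X.Hit l c) : X.cellColor y s r c ≠ y r.2 c.2.1 := by
  rcases r with ⟨_ | l', b⟩
  · cases hl
  · obtain rfl := Option.mem_some_iff.1 hl
    obtain ⟨F, u, j⟩ := c
    obtain ⟨h, hj⟩ := h
    simp only at hj
    subst hj
    refine unitColor_two_ne ?_ h
    have : (∀ v ≤ u, X.Pass y F l' b v) ↔ (∀ v < u, X.Pass y F l' b v) ∧ X.Pass y F l' b u := by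
      simp only [le_iff_lt_or_eq, or_imp, forall_and, forall_eq]
    rw [this, and_assoc]
    exact Iff.rfl.and (Iff.rfl.and (Iff.rfl.and Fin.ext_iff))

theorem cellColor_unit_ne (s : Prop) (r : Option (Reg X.β X.k) × ℕ) (u : Fin X.p) (j j' : Fin 6)
    (hj : j'.val = j + 1) : X.cellColor y s r (F, u, j) ≠ X.cellColor y s r (F, u, j') := by
  rcases r with ⟨_ | l, b⟩
  · have : ∀ j j' : Fin 6, j'.val = j + 1 → (![0, 1, 0, 1, 2, 0] : Fin 6 → ℕ) j ≠
        (![0, 1, 0, 1, 2, 0] : Fin 6 → ℕ) j' ∧ (![1, 0, 1, 0, 1, 0] : Fin 6 → ℕ) j ≠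
        (![1, 0, 1, 0, 1, 0] : Fin 6 → ℕ) j' := by decide
    simp only [cellColor, sepColor]
    split_ifs
    exacts [(this j j' hj).1, (this j j' hj).2]
  · exact unitColor_ne (fun h => ⟨h.1, fun v hv => h.2 v hv.le⟩) _ _ _ _ hj

theorem cellColor_next_ne (s : Prop) (r : Option (Reg X.β X.k) × ℕ) (u u' : Fin X.p) (hu : u'.val = u + 1) :
    X.cellColor y s r (F, u, 5) ≠ X.cellColor y s r (F, u', 0) := by
  rcases r with ⟨_ | l, b⟩
  · simp [cellColor, sepColor, hu]
  · have : (∀ v < u', X.Pass y F l b v) ↔ ∀ v ≤ u, X.Pass y F l b v := by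
      simp only [Fin.lt_def, Fin.le_def, hu, Nat.lt_succ_iff]
    have h₃ := deadColor_ne_zero (F l.2.2 u')
    rw [cellColor_some, cellColor_some, this]
    simp only [unitColor, Matrix.cons_val]
    split_ifs <;> omega

-- The interface between consecutive rows: the last cell shows `0` for a signal and `1` for none,
-- and `cellColor_first` needs to know no more than that.
open Classical in
theorem cellColor_last (s : Prop) (r : Option (Reg X.β X.k) × ℕ) (u : Fin X.p) (hu : u.val + 1 = X.p) :
    X.cellColor y s r (F, u, 5) = 0 ∧ X.step y F s r ∨
      X.cellColor y s r (F, u, 5) = 1 ∧ ¬ X.step y F s r := by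
  rcases r with ⟨_ | l, b⟩
  · refine .inl ⟨?_, fun l hl => by cases hl⟩
    simp [cellColor, sepColor]
  · have : (∀ v ≤ u, X.Pass y F l b v) ↔ ∀ v, X.Pass y F l b v :=
      forall_congr' fun v => imp_iff_right (Fin.le_def.2 (by omega))
    have hs : X.step y F s (some l, b) ↔ s ∧ ∀ v, X.Pass y F l b v :=
      ⟨fun h => h l rfl, fun h l' hl' => by obtain rfl := Option.mem_some_iff.1 hl'; exact h⟩
    have hc : X.cellColor y s (some l, b) (F, u, 5) = if s ∧ ∀ v, X.Pass y F l b v then 0 else 1 := by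
      rw [cellColor_some, this]
      simp only [unitColor, Matrix.cons_val]
      split_ifs <;> rfl
    by_cases h : s ∧ ∀ v, X.Pass y F l b v
    · exact .inl ⟨hc.trans (if_pos h), hs.2 h⟩
    · exact .inr ⟨hc.trans (if_neg h), mt hs.1 h⟩

theorem cellColor_first (s : Prop) (r : Option (Reg X.β X.k) × ℕ) (u : Fin X.p) (hu : u.val = 0) (m : ℕ)
    (hr : r.1 = none → ¬ s) (hm : m = 0 ∧ s ∨ m = 1 ∧ ¬ s) :
    m ≠ X.cellColor y s r (F, u, 0) := by
  rcases r with ⟨_ | l, b⟩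
  · have := hr rfl
    simp only [this, and_false, not_false_eq_true, and_true, false_or] at hm
    simp [cellColor, sepColor, hu, hm]
  · have h₃ := deadColor_ne_zero (F l.2.2 u)
    have : (s ∧ ∀ v < u, X.Pass y F l b v) ↔ s := and_iff_left fun v hv => by
      have := Fin.lt_def.1 hv
      omega
    rw [cellColor_some, this]
    simp only [unitColor, Matrix.cons_val]
    split_ifs with hs
    · simp only [hs, not_true, and_true, and_false, or_false] at hm
      omega
    · simp only [hs, not_false_iff, and_true, and_false, false_or] at hm
      omega

variable {X} {φ : CNF}

theorem exists_valid (h : ∀ (F : X.Lane) (i : Fin (X.spec.rows φ).length),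
    ((X.spec.rows φ).get i).1 = none → ¬ X.signal y F False ((X.spec.rows φ).take i)) :
    ∃ x, X.Valid φ y x := by
  have hq := X.three_le_q
  -- The initial row is colored `1`, which stands for no signal and matches the start value `False`.
  refine ⟨fun a => Fin.cases ⟨1, by omega⟩ (fun i => ⟨X.cellColor y
    (X.signal y a.2.1 False ((X.spec.rows φ).take i)) ((X.spec.rows φ).get i) a.2,
    X.cellColor_lt _ _ _⟩) a.1, ?_, fun i c => X.allowed_cellColor _ _ _,
    ?_⟩
  swap
  · intro i c l hl hit e
    exact X.cellColor_ne_of_hit _ _ c l hl hit (congrArg Fin.val e)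
  rintro ⟨i, F, u, j⟩ ⟨i', F', u', j'⟩ ⟨hF, hlink⟩ e
  have e := congrArg Fin.val e
  simp only at hF hlink e
  subst hF
  have hj := j.2
  have hj' := j'.2
  rcases hlink with ⟨rfl, h₀, h₁⟩ | ⟨h₁, h₂, rfl, h₃, rfl⟩
  · obtain ⟨i, rfl⟩ := Fin.exists_succ_eq.2 h₀
    simp only [Fin.cases_succ] at e
    rcases Nat.lt_or_ge j.val 5 with h5 | h5
    · obtain rfl : u' = u := Fin.ext (by omega)
      exact X.cellColor_unit_ne _ _ _ _ _ (by omega) e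
    · obtain rfl : j = 5 := Fin.ext (by simp only [show ((5 : Fin 6) : ℕ) = 5 from rfl]; omega)
      obtain rfl : j' = 0 := Fin.ext (by
        simp only [show ((5 : Fin 6) : ℕ) = 5 from rfl, Fin.val_zero] at h₁ ⊢; omega)
      exact X.cellColor_next_ne _ _ _ _ (by
        simp only [show ((5 : Fin 6) : ℕ) = 5 from rfl, Fin.val_zero] at h₁; omega) e
  · obtain ⟨i', rfl⟩ := Fin.exists_succ_eq.2 (show i' ≠ 0 by rintro rfl; simp at h₁)
    obtain rfl : i = i'.castSucc := Fin.ext (by simpa using h₁.symm)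
    refine X.cellColor_first _ _ _ h₂ _ (h F i') ?_ e
    clear e
    rcases i' with ⟨_ | i', hi'⟩
    · exact .inr ⟨rfl, fun h => h⟩
    · rw [show (⟨i' + 1, hi'⟩ : Fin _).val = i' + 1 from rfl, X.signal_take_succ _ _ _ (by omega)]
      exact X.cellColor_last _ _ _ h₃

/-- To pass a true literal, the lane would have to agree with `y` on its block and at the same time
make the literal false. So the signal dies within each clause, before the next separator. -/
theorem not_signal_of_satisfies {a : Fin φ.numVars → Bool}
    (ha : ∀ C ∈ φ.clauses, ∃ l ∈ C, a l.1 = l.2)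
    (hy : ∀ v : Fin φ.numVars, X.dec (y (v / X.β)) (X.spec.offset v) = a v) (F : X.Lane)
    (i : Fin (X.spec.rows φ).length) (hi : ((X.spec.rows φ).get i).1 = none) :
    ¬ X.signal y F False ((X.spec.rows φ).take i) := by
  have hlit : ∀ (s : Prop) (ls : List (Fin φ.numVars × Bool)), ∀ l ∈ ls, a l.1 = l.2 →
      ¬ X.signal y F s (X.spec.litRows ls) := by
    intro s ls l hl hal
    rw [signal_litRows]
    rintro ⟨-, h⟩
    obtain ⟨j, hj⟩ : ∃ j, (some (X.spec.reg l.2 l.1 j), l.1.val / X.β) ∈ X.spec.litRows ls := by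
      clear h
      induction ls with
      | nil => simp at hl
      | cons l' ls ih =>
        rcases List.mem_cons.1 hl with rfl | hl
        · exact ⟨_, List.mem_cons_self⟩
        · obtain ⟨j, hj⟩ := ih hl
          exact ⟨j, List.mem_cons_of_mem _ hj⟩
    have hp := h _ hj _ rfl
    refine (hp ⟨0, X.one_le_p⟩).1 ?_
    rw [← funext fun u => (hp u).2]
    exact (hy l.1).trans hal
  have hsome : ∀ (ls : List (Fin φ.numVars × Bool)), ∀ r ∈ X.spec.litRows ls, r.1 ≠ none := by
    intro ls r hr
    obtain ⟨j, hj, rfl⟩ := exists_of_mem_litRows X.spec hr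
    simp
  have key : ∀ (cs : List (List (Fin φ.numVars × Bool))), (∀ C ∈ cs, ∃ l ∈ C, a l.1 = l.2) →
      ∀ rs b rs', X.spec.clauseRows cs ++ [(none, 0)] = rs ++ (none, b) :: rs' →
        ¬ X.signal y F False rs := by
    intro cs
    induction cs with
    | nil =>
      rintro - rs b rs' h
      cases rs with
      | nil => exact id
      | cons r rs => simp [Spec.clauseRows] at h
    | cons C cs ih =>
      intro hcs rs b rs' h
      cases rs with
      | nil => exact id
      | cons r rs =>
        have h' : (none, 0) :: (X.spec.litRows C ++ (X.spec.clauseRows cs ++ [(none, 0)])) =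
            r :: (rs ++ (none, b) :: rs') := by simpa [Spec.clauseRows] using h
        obtain ⟨rfl, h₁⟩ := List.cons.inj h'
        rw [signal_separator]
        obtain ⟨l, hl, hal⟩ := hcs C List.mem_cons_self
        rcases List.append_eq_append_iff.1 h₁ with ⟨t, rfl, ht⟩ | ⟨t, ht, ht'⟩
        · rw [signal_append, eq_false (hlit True C l hl hal)]
          exact ih (fun C' hC' => hcs C' (List.mem_cons_of_mem _ hC')) t b rs' ht
        · cases t with
          | nil =>
            rw [List.append_nil] at ht
            rw [← ht]
            exact hlit True C l hl hal
          | cons r t =>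
            obtain ⟨rfl, -⟩ := List.cons.inj ht'
            exact absurd rfl (hsome C _ (ht ▸ List.mem_append_right _ List.mem_cons_self))
  have hsplit := List.take_append_drop i (X.spec.rows φ)
  rw [List.drop_eq_getElem_cons i.2] at hsplit
  have hget : (X.spec.rows φ)[i.val] = (none, ((X.spec.rows φ).get i).2) := Prod.ext hi rfl
  rw [hget] at hsplit
  exact key φ.clauses ha _ _ _ hsplit.symm

theorem graph_colorable_of_satisfiable (h : φ.Satisfiable) : (X.graph φ).Colorable X.q := by
  obtain ⟨a, ha⟩ := h
  choose f hf using X.dec_surjective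
  -- The last block may contain offsets beyond the last variable; these are filled with `false`.
  refine (X.graph_colorable_iff φ).2 ⟨fun b => f fun o =>
    if h : b * X.β + o < φ.numVars then a ⟨_, h⟩ else false, exists_valid fun F i hi =>
    not_signal_of_satisfies ha (fun v => ?_) F i hi⟩
  have : v.val / X.β * X.β + (X.spec.offset v : Fin X.β).val = v := Nat.div_add_mod' _ _
  rw [hf]
  simp only [this, v.2, dif_pos]

theorem graphInput_colorable_iff (hφ : φ.WidthLE X.k) :
    (X.graphInput φ).graph.Colorable X.q ↔ φ.Satisfiable := by
  rw [X.graphInput_colorable]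
  refine ⟨fun h => ?_, graph_colorable_of_satisfiable⟩
  obtain ⟨y, x, h⟩ := (X.graph_colorable_iff φ).1 h
  exact h.satisfiable hφ

end Design

end FineGrained

namespace FineGrained

/-! ### The parameters of the reduction -/

theorem Design.exists_design {q p β : ℕ} (k : ℕ) (hq : 3 ≤ q) (hp : 1 ≤ p) (hβ : 0 < β)
    (hpβ : 2 ^ β ≤ q ^ p) : ∃ X : Design, X.q = q ∧ X.p = p ∧ X.β = β ∧ X.k = k := by
  obtain ⟨h, H, τ, h₁, h₂, h₃, h₄, h₅⟩ := exists_palette (q := q) (by omega)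
  obtain ⟨f⟩ := Function.Embedding.nonempty_of_card_le (α := Fin β → Bool) (β := Fin p → Fin q)
    (by simpa using hpβ)
  exact ⟨⟨q, p, β, k, h, H, τ, Function.invFun f, hq, hp, hβ, Function.invFun_surjective f.injective,
    h₁, h₂, h₃, h₄, h₅⟩, rfl, rfl, rfl, rfl⟩

theorem exists_block_sizes {q b : ℝ} (hb : 1 ≤ b) (hbq : b < q) {m : ℕ} (hm : q = m) :
    ∃ (p β : ℕ) (x : ℝ), 1 ≤ p ∧ 0 < β ∧ 2 ^ β ≤ m ^ p ∧ 1 ≤ x ∧ x < 2 ∧ b ^ p ≤ x ^ β := by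
  have hb₀ : 0 < b := by linarith
  -- With `q ^ p > 2 * b ^ p`, rounding `q ^ p` down to a power `2 ^ β` loses less than a factor `2`
  -- and stays above `b ^ p`. Hence the `β`-th root `x` of `b ^ p` is below `2`.
  obtain ⟨p, hp⟩ := pow_unbounded_of_one_lt 2 ((one_lt_div hb₀).2 hbq)
  rw [div_pow, lt_div_iff₀ (by positivity)] at hp
  have hbp : 1 ≤ b ^ p := one_le_pow₀ hb
  have hm₀ : m ^ p ≠ 0 := by
    intro h
    have : q ^ p = 0 := by rw [hm]; exact_mod_cast h
    linarith
  have h₁ : 2 ^ Nat.log 2 (m ^ p) ≤ m ^ p := Nat.pow_log_le_self 2 hm₀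
  have h₂ : m ^ p < 2 ^ (Nat.log 2 (m ^ p) + 1) := Nat.lt_pow_succ_log_self (by norm_num) _
  set β := Nat.log 2 (m ^ p)
  have h₃ : b ^ p < 2 ^ β := by
    have : q ^ p < 2 ^ β * 2 := by
      rw [hm, ← pow_succ]
      exact_mod_cast h₂
    linarith
  have hβ : β ≠ 0 := by
    rintro h
    rw [h, pow_zero] at h₃
    linarith
  have hx : ((b ^ p) ^ ((β : ℝ)⁻¹)) ^ β = b ^ p := Real.rpow_inv_natCast_pow (by positivity) hβ
  refine ⟨p, β, (b ^ p) ^ ((β : ℝ)⁻¹), ?_, Nat.pos_of_ne_zero hβ, h₁,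
    Real.one_le_rpow hbp (by positivity), ?_, hx.ge⟩
  · rw [Nat.one_le_iff_ne_zero]
    rintro rfl
    norm_num at hp
  · refine lt_of_pow_lt_pow_left₀ β (by norm_num) ?_
    rwa [hx]

/-! ### The reduction -/

theorem SolvableInOStar.mono {P : ParamProblem} {b b' : ℝ} (h : SolvableInOStar P b) (hb : 0 ≤ b)
    (hbb' : b ≤ b') : SolvableInOStar P b' := by
  obtain ⟨M, p, h⟩ := h
  refine ⟨M, p, fun x => ?_⟩
  obtain ⟨T, ans, hT, h⟩ := h x
  exact ⟨T, ans, hT.trans (by gcongr), h⟩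

theorem eval_le_eval (p : Polynomial ℕ) {m n : ℕ} (h : m ≤ n) : p.eval m ≤ p.eval n := by
  rw [Polynomial.eval_eq_sum_range, Polynomial.eval_eq_sum_range]
  gcongr

theorem Design.solvableInOStar_kSAT (X : Design) {b x : ℝ} (hb : 1 ≤ b) (hx : 1 ≤ x)
    (hbx : b ^ X.p ≤ x ^ X.β) (h : SolvableInOStar (triangleFreeColoring X.q) b) :
    SolvableInOStar (kSAT X.k) x := by
  obtain ⟨A, p, hA⟩ := h
  obtain ⟨K, hK⟩ := Spec.exec_prog X.spec
  let Q : Polynomial ℕ := Polynomial.C K * (Polynomial.X + 1) ^ 2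
  have hQ : ∀ L : ℕ, Q.eval L = K * ((L + 1) * (L + 1)) := by
    intro L
    simp [Q, sq]
  refine ⟨composite (Reg X.spec.β X.spec.k) A X.spec.prog (X.spec.reg false 0 0),
    -- The reduction takes `Q` steps and its output is no longer than that, so the machine for
    -- coloring costs at most `p.comp Q` times `b ^ t`; the factor `b ^ (h + p)` is a constant.
    Q + Polynomial.C ⌈b ^ (X.h + X.p)⌉₊ * p.comp Q, fun ⟨φ, hφ⟩ => ?_⟩
  obtain ⟨T, ans, hT, hans, ⟨hM⟩⟩ := hA ⟨X.graphInput φ, X.graphInput_cliqueFree φ⟩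
  have hexec := hK φ hφ
  rw [X.encode_graphInput] at hT hM
  refine ⟨_, ans, ?_, hans.trans (X.graphInput_colorable_iff hφ), composite_outputs A hexec hM⟩
  change T ≤ _ * b ^ caterpillarDist (X.graphInput φ).graph at hT
  rw [X.caterpillarDist_graphInput] at hT
  change _ ≤ _ * x ^ φ.numVars
  change (((_ : ℕ) + T : ℕ) : ℝ) ≤ (((Q + _).eval φ.encode.length : ℕ) : ℝ) * _
  have hlen : (X.spec.output φ).length ≤ Q.eval φ.encode.length := by
    have := hexec.length_out_le
    rw [hQ]
    simpa [PState.start, PState.final] using this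
  set n := φ.numVars
  set L := φ.encode.length
  have hxn : 1 ≤ x ^ n := one_le_pow₀ hx
  have hpow : b ^ X.spec.modSize φ ≤ ⌈b ^ (X.h + X.p)⌉₊ * x ^ n := by
    have e : X.spec.modSize φ = (X.h + X.p) + X.p * (n / X.β) := by
      rw [Spec.modSize]
      change X.h + X.p * (n / X.β + 1) = _
      ring
    rw [e, pow_add, pow_mul]
    refine mul_le_mul (Nat.le_ceil _) ?_ (by positivity) (by positivity)
    calc (b ^ X.p) ^ (n / X.β) ≤ (x ^ X.β) ^ (n / X.β) := by gcongr
      _ = x ^ (X.β * (n / X.β)) := (pow_mul _ _ _).symm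
      _ ≤ x ^ n := pow_le_pow_right₀ hx (Nat.mul_div_le _ _)
  have hT' : (T : ℝ) ≤ (p.eval (Q.eval L) : ℕ) * (⌈b ^ (X.h + X.p)⌉₊ * x ^ n) :=
    hT.trans (mul_le_mul (by exact_mod_cast eval_le_eval p hlen) hpow (by positivity)
      (by positivity))
  simp only [Polynomial.eval_add, Polynomial.eval_mul, Polynomial.eval_C, Polynomial.eval_comp]
  rw [← hQ]
  push_cast
  have : ((Q.eval L : ℕ) : ℝ) ≤ (Q.eval L : ℕ) * x ^ n := le_mul_of_one_le_right (by positivity) hxn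
  linarith

/-! ### Negative bases -/

/-- The cycle of length four. -/
def squareInput : GraphInput where
  n := 4
  graph := SimpleGraph.fromRel fun u v => v = u + 1
  edges := [(0, 1), (1, 2), (2, 3), (3, 0)]
  adj_iff := by decide

theorem squareInput_cliqueFree : squareInput.graph.CliqueFree 3 := by
  rw [cliqueFree_three_iff]
  have : ∀ a b c : Fin 4, (a ≠ b ∧ (b = a + 1 ∨ a = b + 1)) → (a ≠ c ∧ (c = a + 1 ∨ a = c + 1)) →
    ¬ (b ≠ c ∧ (c = b + 1 ∨ b = c + 1)) := by decide
  exact this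

theorem caterpillarDist_squareInput : caterpillarDist squareInput.graph = 1 := by
  have := caterpillarDist_eq_card (G := squareInput.graph) (ι := Unit) (fun _ j => j)
    (fun _ _ _ _ h => ⟨rfl, h⟩) (fun _ => (by decide :
      ∀ j : Fin 4, j ≠ j + 1 ∧ (j + 1 = j + 1 ∨ j = j + 1 + 1))) Fin.val (fun u v _ _ h => Fin.ext h) ?_
  · simpa using this
  · intro u v hu hv h
    have key : ∀ u v : Fin 4, u ≠ 0 → v ≠ 0 → (u ≠ v ∧ (v = u + 1 ∨ u = v + 1)) →
      u.val = v.val + 1 ∨ v.val = u.val + 1 := by decide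
    exact key u v (hu ()) (hv ()) h

/-- The 4-cycle has parameter `1`, so a negative base leaves no time at all, but the initial
configuration is not a halting one. -/
theorem not_solvableInOStar_of_neg (q : ℕ) {b : ℝ} (hb : b < 0) :
    ¬ SolvableInOStar (triangleFreeColoring q) b := by
  rintro ⟨M, p, h⟩
  obtain ⟨T, ans, hT, -, ⟨⟨⟨m, hm⟩, hmT⟩⟩⟩ := h ⟨squareInput, squareInput_cliqueFree⟩
  change (T : ℝ) ≤ _ * b ^ caterpillarDist squareInput.graph at hT
  rw [caterpillarDist_squareInput, pow_one] at hT
  have hT₀ : (T : ℝ) ≤ 0 := hT.trans (mul_nonpos_of_nonneg_of_nonpos (Nat.cast_nonneg _) hb.le)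
  obtain rfl : m = 0 := by
    have : T = 0 := by exact_mod_cast hT₀.antisymm (Nat.cast_nonneg _)
    simp only at hmT
    omega
  exact nomatch congrArg Turing.TM2.Cfg.l (Option.some.inj hm)

end FineGrained

theorem corollary3p5 (q : ℕ) (hq : 3 ≤ q) (ε : ℝ) (hε : 0 < ε) (hSETH : FineGrained.SETH) :
    ¬ FineGrained.SolvableInOStar (FineGrained.triangleFreeColoring q) ((q : ℝ) - ε) := by
  open FineGrained in
  intro h
  rcases lt_or_ge ((q : ℝ) - ε) 0 with hneg | hpos
  · exact not_solvableInOStar_of_neg q hneg h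
  · have hq' : (3 : ℝ) ≤ q := by exact_mod_cast hq
    -- The estimates need a base of at least `1`; raising the nonnegative base `q - ε` to that only
    -- weakens `h`.
    obtain ⟨p, β, x, hp, hβ, hpβ, hx, hx2, hbx⟩ := exists_block_sizes (b := max 1 ((q : ℝ) - ε))
      (le_max_left _ _) (max_lt (by linarith) (by linarith)) (m := q) rfl
    -- The block sizes do not depend on the clause width, so `k` may be chosen after `x`.
    obtain ⟨k, hk⟩ := hSETH (2 - x) (by linarith)
    rw [sub_sub_cancel] at hk
    obtain ⟨X, rfl, rfl, rfl, rfl⟩ := Design.exists_design k hq hp hβ hpβ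
    exact hk (X.solvableInOStar_kSAT (le_max_left _ _) hx hbx (h.mono hpos (le_max_right _ _)))
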